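/- All Hilbert spaces are complex and separable. For a Hilbert space $\mathcal E$, let $H^2_{\mathcal E}(\mathbb D^n)$ be the Hilbert space of $\mathcal E$-valued analytic functions $f$ on the polydisc $\mathbb D^n$ with $\|f\|^2=\sup_{0\le r<1}\int_{\mathbb T^n}\|f(rz)\|^2\,dm(z)<\infty$, where $m$ is normalized Lebesgue measure on $\mathbb T^n$, and let $M_{z_i}$ be multiplication by $z_i$ on it. A bounded analytic function $\Theta:\mathbb D^n\to\mathcal B(\mathcal E_*,\mathcal E)$ is inner if $M_\Theta f=\Theta f$ defines an isometry $M_\Theta:H^2_{\mathcal E_*}(\mathbb D^n)\to H^2_{\mathcal E}(\mathbb D^n)$. In that case put $\mathcal Q_\Theta=H^2_{\mathcal E}(\mathbb D^n)\ominus\Theta H^2_{\mathcal E_*}(\mathbb D^n)$ (a Beurling quotient module) and $T_\Theta=(P_{\mathcal Q_\Theta}M_{z_1}|_{\mathcal Q_\Theta},\dots,P_{\mathcal Q_\Theta}M_{z_n}|_{\mathcal Q_\Theta})$. Theorem. Let $T=(T_1,\dots,T_n)$ be an $n$-tuple of commuting contractions on a Hilbert space $\mathcal H$. The following are equivalent.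 (a) There are Hilbert spaces $\mathcal E_*$, $\mathcal E$ and an inner function $\Theta$ with values in $\mathcal B(\mathcal E_*,\mathcal E)$ such that $T$ is unitarily equivalent to $T_\Theta$, that is, there is a unitary $U:\mathcal H\to\mathcal Q_\Theta$ with $UT_i=P_{\mathcal Q_\Theta}M_{z_i}|_{\mathcal Q_\Theta}\,U$ for all $i$. (b) $T$ is a Brehmer tuple, that is, $T_i^{*m}\to0$ strongly as $m\to\infty$ for every $i$, and $\sum_{F\subseteq\{1,\dots,n\}}(-1)^{|F|}T_FT_F^*\ge0$, where $T_F=\prod_{j\in F}T_j$ and $T_\emptyset=I_{\mathcal H}$; and $(I_{\mathcal H}-T_i^*T_i)(I_{\mathcal H}-T_j^*T_j)=0$ for all $i\ne j$. -/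

import Mathlib

open MeasureTheory Set Filter Topology
open scoped InnerProductSpace

universe u

noncomputable section

/-- The open unit polydisc `𝔻ⁿ` in `ℂⁿ`. -/
def polydisc (n : ℕ) : Set (Fin n → ℂ) := {z | ∀ i, ‖z i‖ < 1}

/-- The point of the torus `𝕋ⁿ ⊆ ℂⁿ` with coordinates `exp (2 π i t_j)`. The measure `volume` on
`UnitAddTorus (Fin n)` corresponds to the normalized Lebesgue measure on `𝕋ⁿ`. -/
def torusPoint {n : ℕ} (t : UnitAddTorus (Fin n)) : Fin n → ℂ :=
  fun j => (AddCircle.toCircle (t j) : ℂ)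

/-- The integral mean `∫_{𝕋ⁿ} ‖f (r z)‖² dm(z)`. -/
def sqMean {n : ℕ} {E : Type*} [NormedAddCommGroup E] (f : (Fin n → ℂ) → E) (r : ℝ) : ℝ :=
  ∫ t : UnitAddTorus (Fin n), ‖f ((r : ℂ) • torusPoint t)‖ ^ 2

namespace HardySpace

section Auxiliary

instance isProbabilityMeasure_unitAddCircle : IsProbabilityMeasure (volume : Measure UnitAddCircle) :=
  ⟨by simp [AddCircle.measure_univ]⟩

variable {n : ℕ} {E : Type*} [NormedAddCommGroup E] [InnerProductSpace ℂ E]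

theorem polydisc_eq_ball (n : ℕ) : polydisc n = Metric.ball 0 1 := by
  ext z
  simp [polydisc, pi_norm_lt_iff]

theorem isOpen_polydisc (n : ℕ) : IsOpen (polydisc n) := by
  rw [polydisc_eq_ball]; exact Metric.isOpen_ball

theorem continuous_torusPoint : Continuous (torusPoint (n := n)) := by
  unfold torusPoint
  have := @AddCircle.continuous_toCircle (1 : ℝ)
  fun_prop

theorem smul_torusPoint_mem {c : ℂ} (hc : ‖c‖ < 1) (t : UnitAddTorus (Fin n)) :
    c • torusPoint t ∈ polydisc n := by
  intro i
  simpa [torusPoint, Circle.norm_coe] using hc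

theorem torusPoint_add (s : UnitAddCircle) (t : UnitAddTorus (Fin n)) :
    torusPoint ((fun _ => s) + t) = (AddCircle.toCircle s : ℂ) • torusPoint t := by
  ext i
  simp [torusPoint, AddCircle.toCircle_add]

theorem continuous_slice {f : (Fin n → ℂ) → E} (hf : DifferentiableOn ℂ f (polydisc n))
    {r : ℝ} (hr : r ∈ Ico (0 : ℝ) 1) :
    Continuous fun t : UnitAddTorus (Fin n) => f ((r : ℂ) • torusPoint t) :=
  hf.continuousOn.comp_continuous (by have := continuous_torusPoint (n := n); fun_prop)
    fun t => smul_torusPoint_mem (by simpa [abs_of_nonneg hr.1] using hr.2) t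

theorem integrable_of_cont {X F : Type*} [TopologicalSpace X] [CompactSpace X] [MeasurableSpace X]
    [OpensMeasurableSpace X] [SecondCountableTopology X] [NormedAddCommGroup F]
    {μ : Measure X} [IsFiniteMeasure μ]
    {f : X → F} (hf : Continuous f) : Integrable f μ :=
  hf.integrable_of_hasCompactSupport (HasCompactSupport.of_compactSpace f)

theorem circleAverage_eq_integral {F : Type*} [NormedAddCommGroup F] [NormedSpace ℝ F]
    (g : ℂ → F) (R : ℝ) :
    Real.circleAverage g 0 R = ∫ s : UnitAddCircle, g ((R : ℂ) * AddCircle.toCircle s) := by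
  rw [← UnitAddCircle.intervalIntegral_preimage 0, Real.circleAverage_def]
  have := intervalIntegral.integral_comp_mul_left (a := 0) (b := 0 + 1)
    (fun θ => g (circleMap 0 R θ)) (c := 2 * Real.pi) (by positivity)
  simp only [mul_zero, zero_add, mul_one] at this
  rw [← this]
  simp only [zero_add]
  congr 1
  ext x
  rw [AddCircle.toCircle_apply_mk]
  simp [circleMap, Circle.coe_exp]

theorem continuous_circle {F : Type*} [NormedAddCommGroup F] [NormedSpace ℂ F]
    {h : ℂ → F} (hh : DifferentiableOn ℂ h (Metric.ball 0 1))
    {R : ℝ} (hR : R ∈ Ico (0 : ℝ) 1) :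
    Continuous fun s : UnitAddCircle => h ((R : ℂ) * AddCircle.toCircle s) := by
  have := @AddCircle.continuous_toCircle (1 : ℝ)
  refine hh.continuousOn.comp_continuous (by fun_prop) fun s => ?_
  simpa [Circle.norm_coe, abs_of_nonneg hR.1] using hR.2

theorem continuous_poisson {R : ℝ} {w : ℂ} (hw : ‖w‖ < R) :
    Continuous fun s : UnitAddCircle => poissonKernel 0 w ((R : ℂ) * AddCircle.toCircle s) := by
  have := @AddCircle.continuous_toCircle (1 : ℝ)
  unfold poissonKernel
  refine Continuous.div (by fun_prop) (by fun_prop) fun s => ?_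
  have : (R : ℂ) * AddCircle.toCircle s - w ≠ 0 := by
    intro h0
    rw [sub_eq_zero] at h0
    rw [← h0] at hw
    simp only [norm_mul, Complex.norm_real, Circle.norm_coe, mul_one, Real.norm_eq_abs] at hw
    exact absurd hw (not_lt.2 (le_abs_self R))
  simpa using this

theorem poisson_nonneg {R : ℝ} {w : ℂ} (hw : ‖w‖ < R) (s : UnitAddCircle) :
    0 ≤ poissonKernel 0 w ((R : ℂ) * AddCircle.toCircle s) := by
  unfold poissonKernel
  have : ‖w‖ ^ 2 ≤ R ^ 2 := by gcongr
  apply div_nonneg _ (by positivity)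
  simpa [Circle.norm_coe] using this

theorem integral_poisson {R : ℝ} {w : ℂ} (hw : ‖w‖ < R) :
    ∫ s : UnitAddCircle, poissonKernel 0 w ((R : ℂ) * AddCircle.toCircle s) = 1 := by
  have h2 := (diffContOnCl_const (c := (1 : ℂ))).circleAverage_poissonKernel_smul
    (w := w) (c := 0) (R := R) (by simpa using hw)
  rw [circleAverage_eq_integral] at h2
  simp only [Pi.smul_apply', Complex.real_smul, mul_one] at h2
  have h3 := (integral_ofReal (𝕜 := ℂ) (μ := (volume : Measure UnitAddCircle))
    (f := fun s => poissonKernel 0 w ((R : ℂ) * AddCircle.toCircle s))).symm.trans h2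
  exact Complex.ofReal_injective (h3.trans Complex.ofReal_one.symm)

theorem sq_le_poisson [CompleteSpace E] {h : ℂ → E}
    (hh : DifferentiableOn ℂ h (Metric.ball 0 1)) {R : ℝ} (hR : R < 1) {w : ℂ} (hw : ‖w‖ < R) :
    ‖h w‖ ^ 2 ≤ ∫ s : UnitAddCircle, poissonKernel 0 w ((R : ℂ) * AddCircle.toCircle s) *
      ‖h ((R : ℂ) * AddCircle.toCircle s)‖ ^ 2 := by
  have hR0 : 0 < R := (norm_nonneg w).trans_lt hw
  have hD : DiffContOnCl ℂ h (Metric.ball 0 R) :=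
    DifferentiableOn.diffContOnCl (hh.mono (by
      rw [closure_ball _ hR0.ne']; exact Metric.closedBall_subset_ball hR))
  have h1 := hD.circleAverage_poissonKernel_smul (w := w) (by simpa using hw)
  rw [circleAverage_eq_integral] at h1
  have h2 := integral_poisson hw
  have hP := continuous_poisson hw
  have hg := continuous_circle hh ⟨hR0.le, hR⟩
  have hP0 := poisson_nonneg hw
  simp only [Pi.smul_apply'] at h1
  set P : UnitAddCircle → ℝ := fun s => poissonKernel 0 w ((R : ℂ) * AddCircle.toCircle s) with hPd
  set g : UnitAddCircle → E := fun s => h ((R : ℂ) * AddCircle.toCircle s) with hgd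
  set a := h w with ha
  change ∫ s, P s • g s = a at h1
  change ∫ s, P s = 1 at h2
  change ‖a‖ ^ 2 ≤ ∫ s, P s * ‖g s‖ ^ 2
  have h3 : ∫ s, P s * Complex.re ⟪a, g s⟫_ℂ = ‖a‖ ^ 2 := by
    have e1 : ∀ s, P s * Complex.re ⟪a, g s⟫_ℂ = RCLike.re ⟪a, P s • g s⟫_ℂ := by
      intro s
      rw [← Complex.coe_smul, inner_smul_right]
      simp
    simp_rw [e1]
    rw [integral_re (integrable_of_cont (by fun_prop)), integral_inner (integrable_of_cont (by fun_prop)), h1]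
    exact inner_self_eq_norm_sq a
  have h4 : 0 ≤ ∫ s, P s * ‖a - g s‖ ^ 2 :=
    integral_nonneg fun s => mul_nonneg (hP0 s) (by positivity)
  have e2 : ∀ s, P s * ‖a - g s‖ ^ 2 =
      P s * ‖a‖ ^ 2 - 2 * (P s * Complex.re ⟪a, g s⟫_ℂ) + P s * ‖g s‖ ^ 2 := by
    intro s
    rw [@norm_sub_sq ℂ]
    simp only [RCLike.re_to_complex]
    ring
  simp_rw [e2] at h4
  rw [integral_add (integrable_of_cont (by fun_prop)) (integrable_of_cont (by fun_prop)),
    integral_sub (integrable_of_cont (by fun_prop)) (integrable_of_cont (by fun_prop)),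
    integral_mul_const, integral_const_mul, h2, h3] at h4
  linarith

theorem sqMean_mono [CompleteSpace E] {f : (Fin n → ℂ) → E}
    (hf : DifferentiableOn ℂ f (polydisc n)) {r R : ℝ} (hr : 0 ≤ r) (hrR : r ≤ R) (hR : R < 1) :
    sqMean f r ≤ sqMean f R := by
  rcases hrR.eq_or_lt with rfl | hlt
  · exact le_rfl
  have hw : ‖(r : ℂ)‖ < R := by simpa [abs_of_nonneg hr] using hlt
  have hRm : R ∈ Ico (0 : ℝ) 1 := ⟨hr.trans hrR, hR⟩
  have hP := continuous_poisson hw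
  set P : UnitAddCircle → ℝ :=
    fun s => poissonKernel 0 (r : ℂ) ((R : ℂ) * AddCircle.toCircle s) with hPd
  have hc := continuous_slice hf hRm
  have key : ∀ t : UnitAddTorus (Fin n), ‖f ((r : ℂ) • torusPoint t)‖ ^ 2 ≤
      ∫ s : UnitAddCircle, P s * ‖f ((R : ℂ) • torusPoint ((fun _ => s) + t))‖ ^ 2 := by
    intro t
    have hd : DifferentiableOn ℂ (fun c : ℂ => f (c • torusPoint t)) (Metric.ball 0 1) :=
      hf.comp (by fun_prop) fun c hc => smul_torusPoint_mem (by simpa using hc) t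
    have := sq_le_poisson hd hR hw
    simpa only [torusPoint_add, smul_smul] using this
  have hc2 : Continuous (fun p : UnitAddTorus (Fin n) × UnitAddCircle =>
      P p.2 * ‖f ((R : ℂ) • torusPoint ((fun _ => p.2) + p.1))‖ ^ 2) := by
    have : Continuous (fun p : UnitAddTorus (Fin n) × UnitAddCircle =>
      f ((R : ℂ) • torusPoint ((fun _ => p.2) + p.1))) := hc.comp (by fun_prop)
    exact (hP.comp continuous_snd).mul (this.norm.pow 2)
  have hI := integrable_of_cont (μ := (volume : Measure (UnitAddTorus (Fin n))).prod volume) hc2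
  calc sqMean f r ≤ ∫ t : UnitAddTorus (Fin n), ∫ s : UnitAddCircle,
        P s * ‖f ((R : ℂ) • torusPoint ((fun _ => s) + t))‖ ^ 2 :=
        integral_mono (integrable_of_cont
          ((continuous_slice hf ⟨hr, hrR.trans_lt hR⟩).norm.pow 2)) hI.integral_prod_left key
    _ = ∫ s : UnitAddCircle, ∫ t : UnitAddTorus (Fin n),
        P s * ‖f ((R : ℂ) • torusPoint ((fun _ => s) + t))‖ ^ 2 := integral_integral_swap hI
    _ = ∫ s : UnitAddCircle, P s * sqMean f R := by
        congr 1
        ext s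
        rw [integral_const_mul, integral_add_left_eq_self
          (fun t : UnitAddTorus (Fin n) => ‖f ((R : ℂ) • torusPoint t)‖ ^ 2)]
        rfl
    _ = sqMean f R := by
        rw [integral_mul_const, integral_poisson hw, one_mul]

theorem poisson_le {R ρ : ℝ} {w : ℂ} (hw : ‖w‖ ≤ ρ) (hρ : ρ < R) (s : UnitAddCircle) :
    poissonKernel 0 w ((R : ℂ) * AddCircle.toCircle s) ≤ (R + ρ) / (R - ρ) := by
  have hR : 0 < R := (norm_nonneg w).trans_lt (hw.trans_lt hρ)
  have h1 := re_herglotzRieszKernel_le (c := 0) (w := w) (z := (R : ℂ) * AddCircle.toCircle s)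
    (R := R) (by simp [Circle.norm_coe, abs_of_pos hR]) (by simpa using hw.trans_lt hρ)
  rw [poissonKernel_eq_re_herglotzRieszKernel]
  refine le_trans h1 ?_
  rw [sub_zero]
  have : 0 < R - ρ := by linarith
  have : 0 ≤ R + ρ := by linarith [norm_nonneg w]
  gcongr

theorem integral_cons (g : UnitAddTorus (Fin (n + 1)) → ℝ) :
    ∫ p : UnitAddCircle × UnitAddTorus (Fin n),
      g (Fin.cons p.1 p.2 : UnitAddTorus (Fin (n + 1)))
        ∂((volume : Measure UnitAddCircle).prod (volume : Measure (UnitAddTorus (Fin n)))) =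
      ∫ t, g t := by
  have h := (volume_preserving_piFinSuccAbove (fun _ : Fin (n + 1) => UnitAddCircle) 0).symm
  have h2 := h.integral_comp (MeasurableEquiv.measurableEmbedding _) g
  rw [← h2]
  simp only [MeasurableEquiv.piFinSuccAbove_symm_apply, Fin.insertNthEquiv_zero]
  rfl

theorem sq_le_sqMean [CompleteSpace E] {R ρ : ℝ} (hρ0 : 0 ≤ ρ) (hρ : ρ < R) (hR : R < 1) :
    ∀ (n : ℕ) (f : (Fin n → ℂ) → E), DifferentiableOn ℂ f (polydisc n) →
      ∀ w : Fin n → ℂ, (∀ i, ‖w i‖ ≤ ρ) → ‖f w‖ ^ 2 ≤ ((R + ρ) / (R - ρ)) ^ n * sqMean f R := by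
  have hRm : R ∈ Ico (0 : ℝ) 1 := ⟨by linarith, hR⟩
  have hK : 0 ≤ (R + ρ) / (R - ρ) := div_nonneg (by linarith) (by linarith)
  intro n
  induction n with
  | zero =>
    intro f _ w _
    have : ∀ t : UnitAddTorus (Fin 0), ‖f ((R : ℂ) • torusPoint t)‖ ^ 2 = ‖f w‖ ^ 2 :=
      fun t => by rw [Subsingleton.elim ((R : ℂ) • torusPoint t) w]
    simp only [sqMean, this]
    simp
  | succ n ih =>
    intro f hf w hw
    have hcons : ∀ (z : ℂ) (v : Fin n → ℂ), ‖z‖ < 1 → v ∈ polydisc n →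
        (Fin.cons z v : Fin (n + 1) → ℂ) ∈ polydisc (n + 1) := by
      intro z v hz hv i
      refine Fin.cases ?_ (fun j => ?_) i
      · simpa using hz
      · simpa using hv j
    have hw0 : ‖w 0‖ < 1 := (hw 0).trans_lt (hρ.trans hR)
    have hdc1 : ∀ z : ℂ, Differentiable ℂ
        (fun v : Fin n → ℂ => (Fin.cons z v : Fin (n + 1) → ℂ)) := by
      intro z
      rw [differentiable_pi]
      intro i
      refine Fin.cases ?_ (fun j => ?_) i
      · simp
      · simp only [Fin.cons_succ]; fun_prop
    have hdc2 : ∀ v : Fin n → ℂ, Differentiable ℂ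
        (fun z : ℂ => (Fin.cons z v : Fin (n + 1) → ℂ)) := by
      intro v
      rw [differentiable_pi]
      intro i
      refine Fin.cases ?_ (fun j => ?_) i
      · simp only [Fin.cons_zero]; fun_prop
      · simp
    have hf1 : DifferentiableOn ℂ (fun v : Fin n → ℂ => f (Fin.cons (w 0) v)) (polydisc n) :=
      hf.comp (hdc1 _).differentiableOn fun v hv => hcons _ _ hw0 hv
    have h1 := ih _ hf1 (Fin.tail w) (fun i => hw i.succ)
    simp only [Fin.cons_self_tail] at h1
    have hτ : ∀ t : UnitAddTorus (Fin n), (R : ℂ) • torusPoint t ∈ polydisc n :=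
      fun t => smul_torusPoint_mem (by simpa [abs_of_nonneg hRm.1] using hR) t
    have hcF := continuous_slice hf hRm
    have hcons2 : ∀ (s : UnitAddCircle) (t : UnitAddTorus (Fin n)),
        (R : ℂ) • torusPoint (Fin.cons s t : UnitAddTorus (Fin (n + 1))) =
          Fin.cons ((R : ℂ) * AddCircle.toCircle s) ((R : ℂ) • torusPoint t) := by
      intro s t
      ext i
      refine Fin.cases ?_ (fun j => ?_) i
      · simp [torusPoint]
      · simp [torusPoint]
    set G : UnitAddCircle → UnitAddTorus (Fin n) → ℝ := fun s t =>
      ‖f ((R : ℂ) • torusPoint (Fin.cons s t : UnitAddTorus (Fin (n + 1))))‖ ^ 2 with hG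
    have hcG : Continuous (fun p : UnitAddCircle × UnitAddTorus (Fin n) => G p.1 p.2) := by
      have : Continuous (fun p : UnitAddCircle × UnitAddTorus (Fin n) =>
          f ((R : ℂ) • torusPoint (Fin.cons p.1 p.2 : UnitAddTorus (Fin (n + 1))))) := by
        refine hcF.comp (continuous_pi fun i => ?_)
        refine Fin.cases ?_ (fun j => ?_) i
        · simp only [Fin.cons_zero]; fun_prop
        · simp only [Fin.cons_succ]; fun_prop
      exact this.norm.pow 2
    have hIG := integrable_of_cont
      (μ := (volume : Measure UnitAddCircle).prod (volume : Measure (UnitAddTorus (Fin n)))) hcG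
    have h2 : ∀ t : UnitAddTorus (Fin n),
        ‖f (Fin.cons (w 0) ((R : ℂ) • torusPoint t))‖ ^ 2 ≤
          (R + ρ) / (R - ρ) * ∫ s : UnitAddCircle, G s t := by
      intro t
      have hd : DifferentiableOn ℂ (fun z : ℂ => f (Fin.cons z ((R : ℂ) • torusPoint t)))
          (Metric.ball 0 1) :=
        hf.comp (hdc2 _).differentiableOn fun z hz => hcons _ _ (by simpa using hz) (hτ t)
      have hcP := continuous_poisson ((hw 0).trans_lt hρ)
      have hpr : Continuous fun s : UnitAddCircle => (s, t) := by fun_prop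
      have hcGt : Continuous fun s => G s t := by
        have h := hcG.comp hpr
        exact h
      refine (sq_le_poisson hd hR ((hw 0).trans_lt hρ)).trans ?_
      rw [← integral_const_mul]
      simp only [← hcons2]
      refine integral_mono (integrable_of_cont (hcP.mul hcGt))
        (integrable_of_cont (continuous_const.mul hcGt)) fun s => ?_
      exact mul_le_mul_of_nonneg_right (poisson_le (hw 0) hρ s) (sq_nonneg _)
    have h3 : ∫ t : UnitAddTorus (Fin n), ∫ s : UnitAddCircle, G s t = sqMean f R := by
      have e1 := integral_integral_swap (f := G) hIG
      have e2 := integral_integral (f := G) hIG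
      have e3 := integral_cons (n := n) (fun t => ‖f ((R : ℂ) • torusPoint t)‖ ^ 2)
      exact e1.symm.trans (e2.trans e3)
    calc ‖f w‖ ^ 2 ≤ _ := h1
      _ ≤ ((R + ρ) / (R - ρ)) ^ n * ((R + ρ) / (R - ρ) * sqMean f R) := by
        refine mul_le_mul_of_nonneg_left ?_ (pow_nonneg hK n)
        rw [← h3, ← integral_const_mul]
        refine integral_mono (integrable_of_cont ?_) ?_ h2
        · exact (continuous_slice hf1 hRm).norm.pow 2
        · exact (hIG.integral_prod_right).const_mul _
      _ = _ := by ring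


theorem integrable_sqMean {f : (Fin n → ℂ) → E} (hf : DifferentiableOn ℂ f (polydisc n))
    {r : ℝ} (hr : r ∈ Ico (0 : ℝ) 1) :
    Integrable fun t : UnitAddTorus (Fin n) => ‖f ((r : ℂ) • torusPoint t)‖ ^ 2 :=
  integrable_of_cont ((continuous_slice hf hr).norm.pow 2)

theorem sqMean_nonneg {E : Type*} [NormedAddCommGroup E] (f : (Fin n → ℂ) → E) (r : ℝ) : 0 ≤ sqMean f r :=
  integral_nonneg fun _ => sq_nonneg _

theorem sqrt_sqMean_add_le {f g : (Fin n → ℂ) → E} (hf : DifferentiableOn ℂ f (polydisc n))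
    (hg : DifferentiableOn ℂ g (polydisc n)) {r : ℝ} (hr : r ∈ Ico (0 : ℝ) 1) :
    √(sqMean (f + g) r) ≤ √(sqMean f r) + √(sqMean g r) := by
  have key : ∀ h : (Fin n → ℂ) → E, DifferentiableOn ℂ h (polydisc n) →
      MemLp (fun t : UnitAddTorus (Fin n) => h ((r : ℂ) • torusPoint t)) 2 volume ∧
      √(sqMean h r) = (eLpNorm (fun t : UnitAddTorus (Fin n) => h ((r : ℂ) • torusPoint t)) 2
        volume).toReal := by
    intro h hh
    have hc := continuous_slice hh hr
    have hm : MemLp (fun t : UnitAddTorus (Fin n) => h ((r : ℂ) • torusPoint t)) 2 volume :=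
      hc.memLp_of_hasCompactSupport (HasCompactSupport.of_compactSpace _)
    refine ⟨hm, ?_⟩
    rw [hm.eLpNorm_eq_integral_rpow_norm (by norm_num) (by norm_num),
      ENNReal.toReal_ofReal (by positivity), Real.sqrt_eq_rpow]
    simp [sqMean]
  obtain ⟨mf, ef⟩ := key f hf
  obtain ⟨mg, eg⟩ := key g hg
  obtain ⟨-, efg⟩ := key (f + g) (hf.add hg)
  rw [ef, eg, efg, ← ENNReal.toReal_add mf.eLpNorm_ne_top mg.eLpNorm_ne_top]
  exact ENNReal.toReal_mono (ENNReal.add_ne_top.2 ⟨mf.eLpNorm_ne_top, mg.eLpNorm_ne_top⟩)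
    (eLpNorm_add_le mf.1 mg.1 (by norm_num))

theorem sqMean_smul (c : ℂ) (f : (Fin n → ℂ) → E) (r : ℝ) :
    sqMean (c • f) r = ‖c‖ ^ 2 * sqMean f r := by
  simp [sqMean, norm_smul, mul_pow, integral_const_mul]

theorem sqMean_parallelogram {f g : (Fin n → ℂ) → E} (hf : DifferentiableOn ℂ f (polydisc n))
    (hg : DifferentiableOn ℂ g (polydisc n)) {r : ℝ} (hr : r ∈ Ico (0 : ℝ) 1) :
    sqMean (f + g) r + sqMean (f - g) r = 2 * (sqMean f r + sqMean g r) := by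
  unfold sqMean
  rw [← integral_add (integrable_sqMean (hf.add hg) hr) (integrable_sqMean (hf.sub hg) hr),
    ← integral_add (integrable_sqMean hf hr) (integrable_sqMean hg hr), ← integral_const_mul]
  congr 1
  ext t
  simpa [sq] using parallelogram_law_with_norm ℂ (f ((r : ℂ) • torusPoint t))
    (g ((r : ℂ) • torusPoint t))

theorem norm_fderiv_le {g : (Fin n → ℂ) → E} {z : Fin n → ℂ} {δ C : ℝ} (hδ : 0 < δ)
    (hC : 0 ≤ C) (hg : DifferentiableOn ℂ g (Metric.ball z δ))
    (hb : ∀ y ∈ Metric.ball z δ, ‖g y‖ ≤ C) : ‖fderiv ℂ g z‖ ≤ C * 2 / δ := by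
  refine ContinuousLinearMap.opNorm_le_bound _ (by positivity) fun v => ?_
  rcases eq_or_ne v 0 with rfl | hv
  · simp
  have hv' : 0 < ‖v‖ := norm_pos_iff.2 hv
  set R := δ / (2 * ‖v‖) with hR
  have hR0 : 0 < R := by positivity
  have hmem : ∀ c ∈ Metric.closedBall (0 : ℂ) R, z + c • v ∈ Metric.ball z δ := by
    intro c hc
    simp only [Metric.mem_closedBall, dist_zero_right] at hc
    simp only [Metric.mem_ball, dist_eq_norm, add_sub_cancel_left, norm_smul]
    calc ‖c‖ * ‖v‖ ≤ R * ‖v‖ := by gcongr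
      _ = δ / 2 := by rw [hR]; field_simp
      _ < δ := by linarith
  have hd : DifferentiableOn ℂ (fun c : ℂ => g (z + c • v)) (Metric.closedBall 0 R) :=
    hg.comp (by fun_prop) hmem
  have h1 : DiffContOnCl ℂ (fun c : ℂ => g (z + c • v)) (Metric.ball 0 R) :=
    DifferentiableOn.diffContOnCl (by rwa [closure_ball _ hR0.ne'])
  have h2 := Complex.norm_deriv_le_of_forall_mem_sphere_norm_le hR0 h1
    (fun c hc => hb _ (hmem c (Metric.sphere_subset_closedBall hc)))
  have h3 : HasDerivAt (fun c : ℂ => g (z + c • v)) (fderiv ℂ g z v) 0 := by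
    have hgz : HasFDerivAt g (fderiv ℂ g z) (z + (0 : ℂ) • v) := by
      simpa using (hg.differentiableAt (Metric.isOpen_ball.mem_nhds
        (Metric.mem_ball_self hδ))).hasFDerivAt
    have hl : HasDerivAt (fun c : ℂ => z + c • v) v 0 := by
      simpa using ((hasDerivAt_id (0 : ℂ)).smul_const v).const_add z
    exact hgz.comp_hasDerivAt 0 hl
  rw [h3.deriv] at h2
  refine h2.trans (le_of_eq ?_)
  rw [hR]; field_simp

end Auxiliary

end HardySpace

/-- The `E`-valued Hardy functions on `𝔻ⁿ`: analytic functions on `𝔻ⁿ` whose integral means over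
the tori of radius `r < 1` are bounded. A function on `𝔻ⁿ` is represented by its extension by `0`
to `ℂⁿ`, so that equality of functions means equality on `𝔻ⁿ`. -/
def hardySubmodule (n : ℕ) (E : Type*) [NormedAddCommGroup E] [InnerProductSpace ℂ E] :
    Submodule ℂ ((Fin n → ℂ) → E) where
  carrier := {f | DifferentiableOn ℂ f (polydisc n) ∧ (∀ z ∉ polydisc n, f z = 0) ∧
    BddAbove (range fun r : Ico (0 : ℝ) 1 => sqMean f r)}
  zero_mem' := ⟨by fun_prop, by simp, ⟨0, by rintro _ ⟨_, rfl⟩; simp [sqMean]⟩⟩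
  add_mem' := by
    rintro f g ⟨hf, hf0, Cf, hCf⟩ ⟨hg, hg0, Cg, hCg⟩
    refine ⟨hf.add hg, fun z hz => by simp [hf0 z hz, hg0 z hz], 2 * (Cf + Cg), ?_⟩
    rintro _ ⟨r, rfl⟩
    have h1 := HardySpace.sqMean_parallelogram hf hg r.2
    have h2 := HardySpace.sqMean_nonneg (f - g) r
    have h3 : sqMean f r ≤ Cf := hCf ⟨r, rfl⟩
    have h4 : sqMean g r ≤ Cg := hCg ⟨r, rfl⟩
    change sqMean (f + g) r ≤ _
    linarith
  smul_mem' := by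
    rintro c f ⟨hf, hf0, Cf, hCf⟩
    refine ⟨hf.const_smul c, fun z hz => by simp [hf0 z hz], ‖c‖ ^ 2 * Cf, ?_⟩
    rintro _ ⟨r, rfl⟩
    have h3 : sqMean f r ≤ Cf := hCf ⟨r, rfl⟩
    change sqMean (c • f) r ≤ _
    rw [HardySpace.sqMean_smul]
    gcongr

/-- The Hardy space `H²_E(𝔻ⁿ)`. -/
def HardySpace (n : ℕ) (E : Type*) [NormedAddCommGroup E] [InnerProductSpace ℂ E] : Type _ :=
  hardySubmodule n E

namespace HardySpace

variable {n : ℕ} {E : Type*} [NormedAddCommGroup E] [InnerProductSpace ℂ E]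

instance : AddCommGroup (HardySpace n E) := inferInstanceAs (AddCommGroup (hardySubmodule n E))

instance : Module ℂ (HardySpace n E) := inferInstanceAs (Module ℂ (hardySubmodule n E))

instance : CoeFun (HardySpace n E) fun _ => (Fin n → ℂ) → E := ⟨fun f => f.1⟩

/-- The Hardy space norm `(sup_{0 ≤ r < 1} ∫_{𝕋ⁿ} ‖f (r z)‖² dm(z))^{1/2}`. -/
instance : Norm (HardySpace n E) := ⟨fun f => √(⨆ r : Ico (0 : ℝ) 1, sqMean f r)⟩

theorem norm_def (f : HardySpace n E) : ‖f‖ = √(⨆ r : Ico (0 : ℝ) 1, sqMean f r) := rfl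

@[ext] theorem ext {f g : HardySpace n E} (h : ∀ z ∈ polydisc n, f z = g z) : f = g := by
  refine Subtype.ext (funext fun z => ?_)
  by_cases hz : z ∈ polydisc n
  · exact h z hz
  · rw [f.2.2.1 z hz, g.2.2.1 z hz]

theorem norm_sq (f : HardySpace n E) : ‖f‖ ^ 2 = ⨆ r : Ico (0 : ℝ) 1, sqMean f r :=
  Real.sq_sqrt (Real.iSup_nonneg fun r => sqMean_nonneg _ _)

theorem sqMean_le (f : HardySpace n E) {r : ℝ} (hr : r ∈ Ico (0 : ℝ) 1) :
    sqMean f r ≤ ‖f‖ ^ 2 := by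
  rw [norm_sq]
  exact le_ciSup f.2.2.2 ⟨r, hr⟩

instance : Nonempty (Ico (0 : ℝ) 1) := ⟨⟨0, by simp⟩⟩

theorem norm_le_of_sqMean_le (f : HardySpace n E) {C : ℝ} (hC : 0 ≤ C)
    (h : ∀ r ∈ Ico (0 : ℝ) 1, sqMean f r ≤ C ^ 2) : ‖f‖ ≤ C := by
  rw [norm_def, ← Real.sqrt_sq hC]
  exact Real.sqrt_le_sqrt (ciSup_le fun r => h r r.2)

theorem sub_apply (f g : HardySpace n E) (z : Fin n → ℂ) : (f - g) z = f z - g z := rfl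

variable [CompleteSpace E]

theorem tendsto_sqMean (f : HardySpace n E) :
    Tendsto (fun r : Ico (0 : ℝ) 1 => sqMean f r) atTop (𝓝 (‖f‖ ^ 2)) := by
  rw [norm_sq]
  exact tendsto_atTop_ciSup (fun a b hab => sqMean_mono f.2.1 a.2.1 hab b.2.2) f.2.2.2

theorem exists_norm_apply_le (n : ℕ) {ρ : ℝ} (hρ0 : 0 ≤ ρ) (hρ : ρ < 1) :
    ∃ C : ℝ, 0 ≤ C ∧ ∀ (f : HardySpace n E) (w : Fin n → ℂ), (∀ i, ‖w i‖ ≤ ρ) →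
      ‖f w‖ ≤ C * ‖f‖ := by
  have h1 : ρ < (1 + ρ) / 2 := by linarith
  have h2 : (1 + ρ) / 2 < 1 := by linarith
  have hK : 0 ≤ (((1 + ρ) / 2 + ρ) / ((1 + ρ) / 2 - ρ)) ^ n :=
    pow_nonneg (div_nonneg (by linarith) (by linarith)) n
  refine ⟨√((((1 + ρ) / 2 + ρ) / ((1 + ρ) / 2 - ρ)) ^ n), Real.sqrt_nonneg _, fun f w hw => ?_⟩
  have h3 := sq_le_sqMean hρ0 h1 h2 n f f.2.1 w hw
  have h4 := f.sqMean_le (r := (1 + ρ) / 2) ⟨by linarith, h2⟩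
  have hnf : 0 ≤ ‖f‖ := Real.sqrt_nonneg _
  refine le_of_sq_le_sq ?_ (mul_nonneg (Real.sqrt_nonneg _) hnf)
  rw [mul_pow, Real.sq_sqrt hK]
  exact h3.trans (mul_le_mul_of_nonneg_left h4 hK)

theorem core (n : ℕ) (E : Type*) [NormedAddCommGroup E] [InnerProductSpace ℂ E]
    [CompleteSpace E] : NormedSpace.Core ℂ (HardySpace n E) where
  norm_nonneg _ := Real.sqrt_nonneg _
  norm_smul c f := by
    have h1 : ‖c • f‖ ^ 2 = (‖c‖ * ‖f‖) ^ 2 := by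
      rw [mul_pow]
      refine tendsto_nhds_unique (tendsto_sqMean (c • f)) ?_
      refine ((tendsto_sqMean f).const_mul (‖c‖ ^ 2)).congr fun _ => ?_
      exact (sqMean_smul c f _).symm
    exact (sq_eq_sq₀ (Real.sqrt_nonneg _) (mul_nonneg (norm_nonneg _) (Real.sqrt_nonneg _))).1 h1
  norm_triangle f g := by
    have h0 : ∀ h : HardySpace n E, 0 ≤ ‖h‖ := fun _ => Real.sqrt_nonneg _
    refine norm_le_of_sqMean_le _ (add_nonneg (h0 f) (h0 g)) fun r hr => ?_
    have h1 := sqrt_sqMean_add_le f.2.1 g.2.1 hr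
    have h2 : √(sqMean f r) ≤ ‖f‖ := Real.sqrt_le_iff.2 ⟨h0 f, f.sqMean_le hr⟩
    have h3 : √(sqMean g r) ≤ ‖g‖ := Real.sqrt_le_iff.2 ⟨h0 g, g.sqMean_le hr⟩
    exact (Real.sqrt_le_iff.1 (h1.trans (add_le_add h2 h3))).2
  norm_eq_zero_iff f := by
    constructor
    · intro h
      refine HardySpace.ext fun z hz => ?_
      rw [polydisc_eq_ball, mem_ball_zero_iff] at hz
      obtain ⟨C, -, hC⟩ := exists_norm_apply_le (E := E) n (norm_nonneg z) hz
      have := hC f z (fun i => norm_le_pi_norm z i)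
      rw [h, mul_zero] at this
      exact norm_le_zero_iff.1 this
    · rintro rfl
      have : ∀ r : ℝ, sqMean (0 : HardySpace n E) r = 0 := fun _ => by
        change ∫ _, ‖(0 : E)‖ ^ 2 = (0 : ℝ)
        simp
      simp [norm_def, this]

instance : NormedAddCommGroup (HardySpace n E) := NormedAddCommGroup.ofCore (core n E)

instance : NormedSpace ℂ (HardySpace n E) := NormedSpace.ofCore (core n E)

/-- The inner product of `H²_E(𝔻ⁿ)`, obtained from the norm by polarization. -/
instance : InnerProductSpace ℂ (HardySpace n E) :=
  InnerProductSpace.ofNorm ℂ fun f g => by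
    simp only [← sq]
    refine tendsto_nhds_unique ((tendsto_sqMean (f + g)).add (tendsto_sqMean (f - g))) ?_
    refine (((tendsto_sqMean f).add (tendsto_sqMean g)).const_mul 2).congr fun r => ?_
    exact (sqMean_parallelogram f.2.1 g.2.1 r.2).symm

instance : CompleteSpace (HardySpace n E) := by
  refine Metric.complete_of_cauchySeq_tendsto fun u hu => ?_
  -- pointwise limit
  have hloc : ∀ ρ : ℝ, 0 ≤ ρ → ρ < 1 → ∀ ε > 0, ∃ N, ∀ k ≥ N, ∀ m ≥ N, ∀ z : Fin n → ℂ,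
      (∀ i, ‖z i‖ ≤ ρ) → ‖u k z - u m z‖ < ε := by
    intro ρ h0 h1 ε hε
    obtain ⟨C, hC0, hC⟩ := exists_norm_apply_le (E := E) n h0 h1
    obtain ⟨N, hN⟩ := Metric.cauchySeq_iff.1 hu (ε / (C + 1)) (by positivity)
    refine ⟨N, fun k hk m hm z hz => ?_⟩
    have h2 := hC (u k - u m) z hz
    rw [sub_apply] at h2
    have h3 := hN k hk m hm
    rw [dist_eq_norm] at h3
    calc ‖u k z - u m z‖ ≤ C * ‖u k - u m‖ := h2
      _ ≤ (C + 1) * ‖u k - u m‖ := by gcongr; linarith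
      _ < (C + 1) * (ε / (C + 1)) := by gcongr
      _ = ε := by field_simp
  have hpt : ∀ z : Fin n → ℂ, ∃ l : E, Tendsto (fun k => u k z) atTop (𝓝 l) := by
    intro z
    by_cases hz : z ∈ polydisc n
    · rw [polydisc_eq_ball, mem_ball_zero_iff] at hz
      refine cauchySeq_tendsto_of_complete (Metric.cauchySeq_iff.2 fun ε hε => ?_)
      obtain ⟨N, hN⟩ := hloc ‖z‖ (norm_nonneg z) hz ε hε
      exact ⟨N, fun k hk m hm => by
        rw [dist_eq_norm]; exact hN k hk m hm z fun i => norm_le_pi_norm z i⟩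
    · exact ⟨0, tendsto_const_nhds.congr fun k => ((u k).2.2.1 z hz).symm⟩
  choose F hF using hpt
  have hF0 : ∀ z ∉ polydisc n, F z = 0 := fun z hz =>
    tendsto_nhds_unique (hF z) (tendsto_const_nhds.congr fun k => ((u k).2.2.1 z hz).symm)
  have hFd : DifferentiableOn ℂ F (polydisc n) := by
    intro z₀ hz₀
    rw [polydisc_eq_ball, mem_ball_zero_iff] at hz₀
    set δ := (1 - ‖z₀‖) / 3 with hδ
    have hδ0 : 0 < δ := by linarith
    have hsub : ∀ z ∈ Metric.ball z₀ δ, ∀ y ∈ Metric.ball z δ, ‖y‖ ≤ 1 - δ := by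
      intro z hz y hy
      have e1 : ‖y‖ ≤ ‖y - z‖ + ‖z - z₀‖ + ‖z₀‖ := by
        calc ‖y‖ = ‖(y - z) + (z - z₀) + z₀‖ := by congr 1; abel
          _ ≤ _ := norm_add₃_le
      rw [Metric.mem_ball, dist_eq_norm] at hz hy
      linarith
    have hsub2 : ∀ z ∈ Metric.ball z₀ δ, Metric.ball z δ ⊆ polydisc n := by
      intro z hz y hy
      rw [polydisc_eq_ball, mem_ball_zero_iff]
      linarith [hsub z hz y hy]
    have hsub3 : ∀ z ∈ Metric.ball z₀ δ, z ∈ polydisc n := fun z hz =>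
      hsub2 z hz (Metric.mem_ball_self hδ0)
    have hdiff : ∀ k, ∀ z ∈ polydisc n, DifferentiableAt ℂ (u k) z := fun k z hz =>
      (u k).2.1.differentiableAt ((isOpen_polydisc n).mem_nhds hz)
    have hUC : ∀ ε > 0, ∃ N, ∀ k ≥ N, ∀ m ≥ N, ∀ z ∈ Metric.ball z₀ δ,
        dist (fderiv ℂ (u k) z) (fderiv ℂ (u m) z) < ε := by
      intro ε hε
      obtain ⟨N, hN⟩ := hloc (1 - δ) (by linarith [norm_nonneg z₀]) (by linarith)
        (ε * δ / 4) (by positivity)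
      refine ⟨N, fun k hk m hm z hz => ?_⟩
      have hb := norm_fderiv_le (g := (u k - u m : HardySpace n E)) (z := z) hδ0
        (C := ε * δ / 4) (by positivity) ((u k - u m).2.1.mono (hsub2 z hz))
        (fun y hy => (hN k hk m hm y fun i =>
          (norm_le_pi_norm y i).trans (hsub z hz y hy)).le)
      have e2 : fderiv ℂ (u k - u m : HardySpace n E) z = fderiv ℂ (u k) z - fderiv ℂ (u m) z :=
        fderiv_sub (hdiff k z (hsub3 z hz)) (hdiff m z (hsub3 z hz))
      rw [dist_eq_norm, ← e2]
      refine hb.trans_lt ?_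
      field_simp
      linarith
    have hUC' : UniformCauchySeqOn (fun k z => fderiv ℂ (u k) z) atTop (Metric.ball z₀ δ) :=
      Metric.uniformCauchySeqOn_iff.2 hUC
    have hex : ∀ z, ∃ l, z ∈ Metric.ball z₀ δ →
        Tendsto (fun k => fderiv ℂ (u k) z) atTop (𝓝 l) := by
      intro z
      by_cases hz : z ∈ Metric.ball z₀ δ
      · obtain ⟨l, hl⟩ := cauchySeq_tendsto_of_complete (hUC'.cauchySeq hz)
        exact ⟨l, fun _ => hl⟩
      · exact ⟨0, fun h => absurd h hz⟩
    choose g' hg' using hex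
    have := hasFDerivAt_of_tendstoUniformlyOn (x := z₀) Metric.isOpen_ball
      (hUC'.tendstoUniformlyOn_of_tendsto hg')
      (fun k z hz => (hdiff k z (hsub3 z hz)).hasFDerivAt) (fun z _ => hF z)
      (Metric.mem_ball_self hδ0)
    exact this.differentiableAt.differentiableWithinAt
  -- convergence in mean
  have hmean : ∀ ε > 0, ∃ N, ∀ k ≥ N, ∀ r ∈ Ico (0 : ℝ) 1,
      sqMean ((u k : (Fin n → ℂ) → E) - F) r ≤ ε ^ 2 := by
    intro ε hε
    obtain ⟨N, hN⟩ := Metric.cauchySeq_iff.1 hu ε hε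
    refine ⟨N, fun k hk r hr => ?_⟩
    obtain ⟨C, hC0, hC⟩ := exists_norm_apply_le (E := E) n hr.1 hr.2
    have hle : ∀ m ≥ N, ‖u k - u m‖ ≤ ε := fun m hm => by
      rw [← dist_eq_norm]; exact (hN k hk m hm).le
    have hlim : Tendsto (fun m => sqMean (u k - u m : HardySpace n E) r) atTop
        (𝓝 (sqMean ((u k : (Fin n → ℂ) → E) - F) r)) := by
      refine tendsto_integral_filter_of_dominated_convergence (fun _ => (C * ε) ^ 2) ?_ ?_
        (integrable_const _) ?_
      · exact Eventually.of_forall fun m =>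
          ((continuous_slice (u k - u m).2.1 hr).norm.pow 2).aestronglyMeasurable
      · filter_upwards [eventually_ge_atTop N] with m hm
        refine Eventually.of_forall fun t => ?_
        have h1 := hC (u k - u m) ((r : ℂ) • torusPoint t) (fun i => by
          simp [torusPoint, Circle.norm_coe, abs_of_nonneg hr.1])
        rw [Real.norm_of_nonneg (sq_nonneg _)]
        have h2 := hle m hm
        gcongr
        exact h1.trans (by gcongr)
      · exact Eventually.of_forall fun t =>
          ((tendsto_const_nhds.sub (hF ((r : ℂ) • torusPoint t))).norm.pow 2)
    refine le_of_tendsto hlim ?_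
    filter_upwards [eventually_ge_atTop N] with m hm
    refine ((u k - u m).sqMean_le hr).trans ?_
    have := hle m hm
    gcongr
  have hdm : ∀ k, (∃ C, ∀ r ∈ Ico (0 : ℝ) 1, sqMean ((u k : (Fin n → ℂ) → E) - F) r ≤ C) →
      ((u k : (Fin n → ℂ) → E) - F) ∈ hardySubmodule n E := by
    rintro k ⟨C, hC⟩
    refine ⟨(u k).2.1.sub hFd, fun z hz => ?_, C, ?_⟩
    · simp [(u k).2.2.1 z hz, hF0 z hz]
    · rintro _ ⟨r, rfl⟩
      exact hC r r.2
  have hFm : F ∈ hardySubmodule n E := by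
    obtain ⟨N, hN⟩ := hmean 1 one_pos
    have := (hardySubmodule n E).sub_mem (u N).2 (hdm N ⟨_, hN N le_rfl⟩)
    simpa using this
  obtain ⟨G, rfl⟩ : ∃ G : HardySpace n E, (G : (Fin n → ℂ) → E) = F := ⟨⟨F, hFm⟩, rfl⟩
  refine ⟨G, Metric.tendsto_atTop.2 fun ε hε => ?_⟩
  obtain ⟨N, hN⟩ := hmean (ε / 2) (by positivity)
  refine ⟨N, fun k hk => ?_⟩
  rw [dist_eq_norm]
  exact (norm_le_of_sqMean_le (u k - G) (by positivity) (hN k hk)).trans_lt (by linarith)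

end HardySpace
/-- `H^∞_{B(Estar, E)}(𝔻ⁿ)`: bounded analytic functions on `𝔻ⁿ` with values in the bounded
operators from `Estar` to `E`. Only the values of `toFun` on `𝔻ⁿ` are used. -/
structure HInfty (n : ℕ) (Estar E : Type*) [NormedAddCommGroup Estar] [InnerProductSpace ℂ Estar]
    [NormedAddCommGroup E] [InnerProductSpace ℂ E] where
  toFun : (Fin n → ℂ) → Estar →L[ℂ] E
  differentiableOn : DifferentiableOn ℂ toFun (polydisc n)
  bounded : ∃ C : ℝ, ∀ z ∈ polydisc n, ‖toFun z‖ ≤ C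

section Operators

variable {n : ℕ} {Estar E : Type*} [NormedAddCommGroup Estar] [InnerProductSpace ℂ Estar]
  [NormedAddCommGroup E] [InnerProductSpace ℂ E]

theorem HInfty.sqMean_mul_le (Θ : HInfty n Estar E) {C : ℝ}
    (hC : ∀ z ∈ polydisc n, ‖Θ.toFun z‖ ≤ C) (f : HardySpace n Estar) {r : ℝ}
    (hr : r ∈ Ico (0 : ℝ) 1) :
    sqMean (fun z => Θ.toFun z (f z)) r ≤ C ^ 2 * sqMean f r := by
  unfold sqMean
  rw [← integral_const_mul]
  refine integral_mono (HardySpace.integrable_sqMean (Θ.differentiableOn.clm_apply f.2.1) hr)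
    ((HardySpace.integrable_sqMean f.2.1 hr).const_mul _) fun t => ?_
  change ‖_‖ ^ 2 ≤ C ^ 2 * ‖_‖ ^ 2
  rw [← mul_pow]
  gcongr
  refine (ContinuousLinearMap.le_opNorm _ _).trans ?_
  gcongr
  exact hC _ (HardySpace.smul_torusPoint_mem (by simpa [abs_of_nonneg hr.1] using hr.2) t)

variable [CompleteSpace Estar] [CompleteSpace E]

/-- The multiplication operator `M_Θ : H²_{Estar}(𝔻ⁿ) → H²_E(𝔻ⁿ)`, `(M_Θ f)(z) = Θ(z) f(z)`. -/
def mulOp (Θ : HInfty n Estar E) : HardySpace n Estar →L[ℂ] HardySpace n E :=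
  LinearMap.mkContinuousOfExistsBound
    { toFun := fun f => ⟨fun z => Θ.toFun z (f z), by
        obtain ⟨C, hC⟩ := Θ.bounded
        refine ⟨Θ.differentiableOn.clm_apply f.2.1, fun z hz => by simp [f.2.2.1 z hz],
          C ^ 2 * ‖f‖ ^ 2, ?_⟩
        rintro _ ⟨r, rfl⟩
        refine (Θ.sqMean_mul_le hC f r.2).trans ?_
        gcongr
        exact f.sqMean_le r.2⟩
      map_add' := fun f g => HardySpace.ext fun z _ => map_add (Θ.toFun z) (f z) (g z)
      map_smul' := fun c f => HardySpace.ext fun z _ => map_smul (Θ.toFun z) c (f z) }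
    (by
      obtain ⟨C, hC⟩ := Θ.bounded
      have hC0 : 0 ≤ C := (norm_nonneg _).trans (hC 0 (fun i => by simp))
      refine ⟨C, fun f => HardySpace.norm_le_of_sqMean_le _ (by positivity) fun r hr => ?_⟩
      refine (Θ.sqMean_mul_le hC f hr).trans ?_
      rw [mul_pow]
      gcongr
      exact f.sqMean_le hr)

theorem mulOp_apply (Θ : HInfty n Estar E) (f : HardySpace n Estar) (z : Fin n → ℂ) :
    mulOp Θ f z = Θ.toFun z (f z) := rfl

/-- `Θ` is inner if `M_Θ` is an isometry. -/
def IsInner (Θ : HInfty n Estar E) : Prop := Isometry (mulOp Θ)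

/-- The function `z ↦ z_i I_E`. -/
def coordFn (n : ℕ) (E : Type*) [NormedAddCommGroup E] [InnerProductSpace ℂ E] (i : Fin n) :
    HInfty n E E where
  toFun z := z i • ContinuousLinearMap.id ℂ E
  differentiableOn := by fun_prop
  bounded := ⟨1, fun z hz => by
    rw [norm_smul]
    exact mul_le_one₀ (hz i).le (norm_nonneg _) ContinuousLinearMap.norm_id_le⟩

/-- The operator `M_{z_i}` on `H²_E(𝔻ⁿ)`. -/
def shift (n : ℕ) (E : Type*) [NormedAddCommGroup E] [InnerProductSpace ℂ E] [CompleteSpace E]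
    (i : Fin n) : HardySpace n E →L[ℂ] HardySpace n E :=
  mulOp (coordFn n E i)

theorem shift_apply (i : Fin n) (f : HardySpace n E) (z : Fin n → ℂ) :
    shift n E i f z = z i • f z := rfl

/-- `Q_Θ = H²_E(𝔻ⁿ) ⊖ Θ H²_{Estar}(𝔻ⁿ)`; a Beurling quotient module when `Θ` is inner. -/
def modelSpace (Θ : HInfty n Estar E) : Submodule ℂ (HardySpace n E) :=
  (LinearMap.range (mulOp Θ).toLinearMap)ᗮ

instance (Θ : HInfty n Estar E) : CompleteSpace (modelSpace Θ) :=
  inferInstanceAs (CompleteSpace ((LinearMap.range (mulOp Θ).toLinearMap)ᗮ : Submodule ℂ _))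

/-- The tuple `T_Θ`, with entries `P_{Q_Θ} M_{z_i}|_{Q_Θ}`. -/
def compressedShift (Θ : HInfty n Estar E) (i : Fin n) : modelSpace Θ →L[ℂ] modelSpace Θ :=
  (modelSpace Θ).orthogonalProjectionOnto ∘L shift n E i ∘L (modelSpace Θ).subtypeL

end Operators

/-- Unitary equivalence of two `n`-tuples of operators. -/
def UnitarilyEquivalent {n : ℕ} {H K : Type*} [NormedAddCommGroup H] [InnerProductSpace ℂ H]
    [NormedAddCommGroup K] [InnerProductSpace ℂ K] (T : Fin n → H →L[ℂ] H)
    (R : Fin n → K →L[ℂ] K) : Prop :=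
  ∃ U : H ≃ₗᵢ[ℂ] K, ∀ i x, U (T i x) = R i (U x)

section Brehmer

variable {H : Type*} [NormedAddCommGroup H] [InnerProductSpace ℂ H]

/-- The product `T_F = ∏_{j ∈ F} T_j` of members of a commuting tuple. -/
def tupleProd {n : ℕ} (T : Fin n → H →L[ℂ] H) (hT : ∀ i j, Commute (T i) (T j))
    (F : Finset (Fin n)) : H →L[ℂ] H :=
  F.noncommProd T fun i _ j _ _ => hT i j

variable [CompleteSpace H]

/-- `X` is pure if the powers of `X*` converge strongly to `0`. -/
def IsPureOperator (X : H →L[ℂ] H) : Prop :=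
  ∀ x, Tendsto (fun m : ℕ => (ContinuousLinearMap.adjoint X ^ m) x) atTop (𝓝 0)

/-- A commuting tuple of contractions is Brehmer if every `T_i` is pure and
`∑_F (-1)^|F| T_F T_F*` is a positive operator. -/
def IsBrehmer {n : ℕ} (T : Fin n → H →L[ℂ] H) (hT : ∀ i j, Commute (T i) (T j)) : Prop :=
  (∀ i, IsPureOperator (T i)) ∧
    (∑ F : Finset (Fin n), (-1 : ℂ) ^ F.card •
      (tupleProd T hT F * ContinuousLinearMap.adjoint (tupleProd T hT F))).IsPositive

end Brehmer

end

/-! Let `M i` be the coordinate shifts on a vector-valued Hardy space, let `P` be the projection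
onto a subspace `Q` invariant under every `(M i)†`, and let `S` be the orthogonal complement of `Q`.
Being a Brehmer tuple accounts for a realization of `T` as the compression of the `M i` to such a
`Q`; the identity on the defects `1 - T_i* T_i` then decides whether `S` has the form `Θ H²`.

For the realization, let `D` be the square root of the positive operator `∑_F (-1)^|F| T_F T_F*`.
Telescoping and purity give `∑_k ‖D T^{*k} x‖² = ‖x‖²` (`hasSum_norm_sq_defect`), so sending `x` to
the power series with coefficients `D T^{*k} x` is an isometry that turns each `T_i*` into the
backward shift (`exists_dilation`). Conversely, compressions of a doubly commuting tuple of pure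
isometries are Brehmer, because for such isometries the alternating sum is the projection onto the
wandering subspace (`IsDoublyCommutingShift.isBrehmer`).

For the identity, put `B_i = (1 - P) M_i P`, where `P` projects onto the copy of the space of `T`.
Then `1 - T_i* T_i` corresponds to `B_i* B_i`, and a product of two of these vanishes exactly when
`B_i B_j* = (1 - P) M_i P M_j* (1 - P)` does (`defect_mul_defect_eq_zero_iff`). For `i ≠ j` the
shifts satisfy `M_i M_j* = M_j* M_i`, so this operator is the obstruction to double commutation of
the restrictions `M_i|S`.

It remains to see that the `M_i|S` doubly commute exactly when `S = Θ H²` with `Θ` inner. If `S = Θ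
H²`, then `M_Θ` carries the shifts, which doubly commute, onto the restrictions. If the restrictions
doubly commute, the Wold decomposition (`IsDoublyCommutingShift.exists_unitary`) identifies `S` with
a Hardy space over its wandering subspace, and the resulting isometry between Hardy spaces commutes
with the shifts, hence is multiplication by a bounded analytic function (`exists_mulOp_eq`). -/

open scoped InnerProduct

noncomputable section

/-! ### Powers of a commuting tuple and the telescoping norm identity. -/

section TuplePow

variable {n : ℕ} {H : Type*} [NormedAddCommGroup H] [InnerProductSpace ℂ H]

theorem pairwise_commute_pow {T : Fin n → H →L[ℂ] H} (hT : ∀ i j, Commute (T i) (T j))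
    (k : Fin n → ℕ) : ((Finset.univ : Finset (Fin n)) : Set (Fin n)).Pairwise
      (Function.onFun Commute fun i => T i ^ k i) :=
  fun i _ j _ _ => (hT i j).pow_pow _ _

/-- The product `∏ i, T i ^ k i` of powers of the members of a commuting tuple. -/
def tuplePow (T : Fin n → H →L[ℂ] H) (hT : ∀ i j, Commute (T i) (T j)) (k : Fin n → ℕ) :
    H →L[ℂ] H :=
  Finset.univ.noncommProd (fun i => T i ^ k i) (pairwise_commute_pow hT k)

variable {T : Fin n → H →L[ℂ] H} {hT : ∀ i j, Commute (T i) (T j)}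

theorem tuplePow_add (k l : Fin n → ℕ) :
    tuplePow T hT (k + l) = tuplePow T hT k * tuplePow T hT l := by
  unfold tuplePow
  rw [← Finset.noncommProd_mul_distrib _ _ _ _ fun i _ j _ _ => (hT i j).pow_pow _ _]
  exact Finset.noncommProd_congr rfl (fun i _ => pow_add _ _ _) _

@[simp] theorem tuplePow_zero : tuplePow T hT 0 = 1 := by
  unfold tuplePow
  rw [Finset.noncommProd_eq_pow_card _ _ _ 1 (by simp), one_pow]

@[simp] theorem tuplePow_single (i : Fin n) (m : ℕ) :
    tuplePow T hT (Pi.single i m) = T i ^ m := by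
  have h1 := Finset.mul_noncommProd_erase Finset.univ (Finset.mem_univ i)
    (fun j => T j ^ (Pi.single i m : Fin n → ℕ) j) (pairwise_commute_pow hT _)
    ((pairwise_commute_pow hT _).mono fun _ _ => by simp)
  have h2 := Finset.noncommProd_eq_pow_card (Finset.univ.erase i)
    (fun j => T j ^ (Pi.single i m : Fin n → ℕ) j)
    ((pairwise_commute_pow hT _).mono fun _ _ => by simp) 1
    fun j hj => by simp [Pi.single_eq_of_ne (Finset.ne_of_mem_erase hj)]
  rw [h2, one_pow, mul_one, Pi.single_eq_same] at h1
  exact h1.symm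

theorem tupleProd_eq_tuplePow (F : Finset (Fin n)) :
    tupleProd T hT F = tuplePow T hT (fun i => if i ∈ F then 1 else 0) := by
  induction F using Finset.induction_on with
  | empty =>
    have : (fun i : Fin n => if i ∈ (∅ : Finset (Fin n)) then 1 else 0) = (0 : Fin n → ℕ) := by
      ext; simp
    rw [this, tuplePow_zero]
    rfl
  | insert a F ha ih =>
    have : (fun i => if i ∈ insert a F then 1 else 0) =
        Pi.single a 1 + (fun i => if i ∈ F then 1 else 0) := by
      ext i
      rcases eq_or_ne i a with rfl | h
      · simp [ha]
      · simp [h]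
    rw [this, tuplePow_add, tuplePow_single, pow_one, ← ih]
    exact Finset.noncommProd_insert_of_notMem _ _ _ _ ha

theorem norm_tuplePow_le (hc : ∀ i, ‖T i‖ ≤ 1) (k : Fin n → ℕ) : ‖tuplePow T hT k‖ ≤ 1 := by
  refine Finset.noncommProd_induction _ _ _ (fun X : H →L[ℂ] H => ‖X‖ ≤ 1) ?_ ?_ ?_
  · exact fun a b ha hb => (norm_mul_le a b).trans (mul_le_one₀ ha (norm_nonneg _) hb)
  · exact ContinuousLinearMap.norm_id_le
  · intro i _
    induction k i with
    | zero => exact ContinuousLinearMap.norm_id_le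
    | succ m ih =>
      rw [pow_succ]
      exact (norm_mul_le _ _).trans (mul_le_one₀ ih (norm_nonneg _) (hc i))

theorem exists_eq_single_add {k : Fin n → ℕ} {i : Fin n} {m : ℕ} (h : m ≤ k i) :
    ∃ l : Fin n → ℕ, k = Pi.single i m + l := by
  refine ⟨k - Pi.single i m, funext fun j => ?_⟩
  rcases eq_or_ne j i with rfl | hj
  · simp [Nat.add_sub_cancel' h]
  · simp [hj]

/-- Induction on the total degree `∑ i, k i`. -/
theorem multiindex_induction {p : (Fin n → ℕ) → Prop} (h0 : p 0)
    (hs : ∀ (i : Fin n) (l : Fin n → ℕ), p l → p (Pi.single i 1 + l)) (k : Fin n → ℕ) : p k := by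
  obtain ⟨d, hk⟩ : ∃ d, ∑ i, k i = d := ⟨_, rfl⟩
  induction d generalizing k with
  | zero =>
    have : k = 0 := funext fun i => (Finset.sum_eq_zero_iff.1 hk) i (Finset.mem_univ i)
    rwa [this]
  | succ d ih =>
    obtain ⟨i, -, hi⟩ := Finset.exists_ne_zero_of_sum_ne_zero (hk.trans_ne d.succ_ne_zero)
    obtain ⟨l, rfl⟩ := exists_eq_single_add (i := i) (m := 1) (Nat.pos_of_ne_zero hi)
    refine hs i l (ih l ?_)
    simp [Finset.sum_add_distrib] at hk
    omega

variable [CompleteSpace H]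

theorem adjoint_tuplePow_add_apply (k l : Fin n → ℕ) (x : H) :
    ((tuplePow T hT (k + l))†) x = ((tuplePow T hT k)†) (((tuplePow T hT l)†) x) := by
  rw [add_comm, tuplePow_add]
  change ((tuplePow T hT l ∘L tuplePow T hT k)†) x = _
  rw [ContinuousLinearMap.adjoint_comp]
  rfl

theorem adjoint_pow_eq (X : H →L[ℂ] H) (m : ℕ) : (X ^ m)† = X† ^ m := star_pow X m

theorem adjoint_tuplePow_single_add_apply (i : Fin n) (m : ℕ) (l : Fin n → ℕ) (x : H) :
    ((tuplePow T hT (Pi.single i m + l))†) x = ((tuplePow T hT l)†) ((((T i)†) ^ m) x) := by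
  rw [add_comm, adjoint_tuplePow_add_apply, tuplePow_single, adjoint_pow_eq]

/-- The linear functional on polynomials sending `X ^ k` to `‖(T ^ k)* x‖²`. -/
def hereditaryForm (T : Fin n → H →L[ℂ] H) (hT : ∀ i j, Commute (T i) (T j)) (x : H) :
    MvPolynomial (Fin n) ℝ →ₗ[ℝ] ℝ :=
  (MvPolynomial.basisMonomials (Fin n) ℝ).constr ℝ fun k => ‖((tuplePow T hT k)†) x‖ ^ 2

theorem hereditaryForm_monomial (x : H) (k : Fin n →₀ ℕ) :
    hereditaryForm T hT x (MvPolynomial.monomial k 1) = ‖((tuplePow T hT k)†) x‖ ^ 2 := by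
  have := (MvPolynomial.basisMonomials (Fin n) ℝ).constr_basis ℝ
    (fun k => ‖((tuplePow T hT k)†) x‖ ^ 2) k
  rwa [MvPolynomial.coe_basisMonomials] at this

/-- Both sides are linear in `p`, and on monomials the identity is `T^{*(l+k)} = T^{*l} T^{*k}`.
Thus replacing `x` by `T^{*k} x` becomes multiplication by `X^k`, and identities for alternating
sums of norms reduce to identities between polynomials. -/
theorem hereditaryForm_mul_monomial (x : H) (k : Fin n →₀ ℕ) (p : MvPolynomial (Fin n) ℝ) :
    hereditaryForm T hT x (p * MvPolynomial.monomial k 1) =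
      hereditaryForm T hT (((tuplePow T hT k)†) x) p := by
  have : hereditaryForm T hT x ∘ₗ LinearMap.mulRight ℝ (MvPolynomial.monomial k 1) =
      hereditaryForm T hT (((tuplePow T hT k)†) x) := by
    refine (MvPolynomial.basisMonomials (Fin n) ℝ).ext fun l => ?_
    rw [MvPolynomial.coe_basisMonomials, LinearMap.comp_apply, LinearMap.mulRight_apply,
      MvPolynomial.monomial_mul, mul_one, hereditaryForm_monomial, hereditaryForm_monomial,
      Finsupp.coe_add, adjoint_tuplePow_add_apply]
  exact LinearMap.congr_fun this p

theorem prod_X_pow_eq (k : Fin n → ℕ) :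
    ∏ i, (MvPolynomial.X i : MvPolynomial (Fin n) ℝ) ^ k i =
      MvPolynomial.monomial (Finsupp.equivFunOnFinite.symm k) 1 := by
  rw [MvPolynomial.monomial_eq, Finsupp.prod_fintype _ _ (by simp)]
  simp

theorem hereditaryForm_prod_one_sub (x : H) (N : ℕ) :
    hereditaryForm T hT x (∏ i, (1 - MvPolynomial.X i ^ N)) =
      ∑ F : Finset (Fin n), (-1) ^ F.card *
        ‖(((tuplePow T hT (fun i => if i ∈ F then N else 0))†)) x‖ ^ 2 := by
  have h1 : (∏ i : Fin n, (1 - (MvPolynomial.X i : MvPolynomial (Fin n) ℝ) ^ N)) =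
      ∑ F : Finset (Fin n), ((-1 : ℝ) ^ F.card) • MvPolynomial.monomial
        (Finsupp.equivFunOnFinite.symm (fun i => if i ∈ F then N else 0)) (1 : ℝ) := by
    simp_rw [sub_eq_add_neg]
    rw [Finset.prod_one_add, Finset.powerset_univ]
    refine Finset.sum_congr rfl fun F _ => ?_
    rw [Finset.prod_neg, ← prod_X_pow_eq, MvPolynomial.smul_eq_C_mul]
    congr 1
    · simp
    · simp [pow_ite, Finset.prod_ite_mem]
  rw [h1, map_sum]
  refine Finset.sum_congr rfl fun F _ => ?_
  rw [map_smul, hereditaryForm_monomial, smul_eq_mul]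
  rfl

/-- In polynomial form, `‖D y‖²` is the value of the form at `∏ (1 - X_i)`. Summing over the box
multiplies this by `∏_i ∑_{m<N} X_i^m`, and the geometric sums collapse the product to `∏ (1 -
X_i^N)`. -/
theorem sum_box_eq {G : Type*} [NormedAddCommGroup G] [InnerProductSpace ℂ G] {D : H →L[ℂ] G}
    (hD : ∀ x, ‖D x‖ ^ 2 =
      ∑ F : Finset (Fin n), (-1) ^ F.card * ‖((tupleProd T hT F)†) x‖ ^ 2) (x : H) (N : ℕ) :
    ∑ k ∈ Fintype.piFinset (fun _ : Fin n => Finset.range N), ‖D (((tuplePow T hT k)†) x)‖ ^ 2 =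
      ∑ F : Finset (Fin n), (-1) ^ F.card *
        ‖(((tuplePow T hT (fun i => if i ∈ F then N else 0))†)) x‖ ^ 2 := by
  have h1 : ∀ y, ‖D y‖ ^ 2 = hereditaryForm T hT y (∏ i, (1 - MvPolynomial.X i)) := by
    intro y
    have := hereditaryForm_prod_one_sub (hT := hT) y 1
    simp only [pow_one] at this
    rw [hD, this]
    simp_rw [tupleProd_eq_tuplePow]
  have h2 : ∀ k : Fin n → ℕ, ‖D (((tuplePow T hT k)†) x)‖ ^ 2 = hereditaryForm T hT x
      ((∏ i, (1 - MvPolynomial.X i)) * ∏ i, MvPolynomial.X i ^ k i) := by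
    intro k
    rw [prod_X_pow_eq, hereditaryForm_mul_monomial, h1]
    rfl
  simp_rw [h2]
  rw [← map_sum, ← Finset.mul_sum, ← Finset.prod_univ_sum, ← Finset.prod_mul_distrib,
    ← hereditaryForm_prod_one_sub]
  congr 1
  refine Finset.prod_congr rfl fun i _ => ?_
  rw [mul_neg_geom_sum]

/-- For one `i ∈ F` the factor `T_i^{*N}` is applied to `x` first and tends to zero by purity; the
remaining factors form a contraction. -/
theorem tendsto_adjoint_tuplePow (hc : ∀ i, ‖T i‖ ≤ 1) (hp : ∀ i, IsPureOperator (T i))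
    {F : Finset (Fin n)} (hF : F.Nonempty) (x : H) :
    Tendsto (fun N => (((tuplePow T hT (fun i => if i ∈ F then N else 0))†)) x) atTop (𝓝 0) := by
  obtain ⟨i, hi⟩ := hF
  refine squeeze_zero_norm (fun N => ?_) ((tendsto_zero_iff_norm_tendsto_zero).1 (hp i x))
  obtain ⟨l, hl⟩ := exists_eq_single_add (k := fun i => if i ∈ F then N else 0) (i := i) (m := N)
    (by simp [hi])
  rw [hl, adjoint_tuplePow_single_add_apply]
  refine (ContinuousLinearMap.le_opNorm _ _).trans ?_
  rw [LinearIsometryEquiv.norm_map]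
  exact mul_le_of_le_one_left (norm_nonneg _) (norm_tuplePow_le hc l)

theorem exists_subset_box (s : Finset (Fin n → ℕ)) :
    ∃ N₀, ∀ N ≥ N₀, s ⊆ Fintype.piFinset (fun _ : Fin n => Finset.range N) := by
  refine ⟨s.sup (fun k => Finset.univ.sup k) + 1, fun N hN k hk => ?_⟩
  rw [Fintype.mem_piFinset]
  intro i
  rw [Finset.mem_range]
  have h1 : k i ≤ Finset.univ.sup k := Finset.le_sup (Finset.mem_univ i)
  have h2 : Finset.univ.sup k ≤ s.sup (fun k => Finset.univ.sup k) :=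
    Finset.le_sup (f := fun k : Fin n → ℕ => Finset.univ.sup k) hk
  omega

/-- Every finite set of indices lies in all large boxes. Nonnegativity then bounds all finite sums
by the limit along boxes, which gives unconditional summability, and the boxes identify the sum. -/
theorem hasSum_of_tendsto_box {f : (Fin n → ℕ) → ℝ} (hf : ∀ k, 0 ≤ f k) {a : ℝ}
    (h : Tendsto (fun N => ∑ k ∈ Fintype.piFinset (fun _ : Fin n => Finset.range N), f k)
      atTop (𝓝 a)) : HasSum f a := by
  have hbox : Tendsto (fun N => Fintype.piFinset (fun _ : Fin n => Finset.range N)) atTop atTop :=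
    tendsto_atTop.2 fun s => by
      obtain ⟨N₀, h0⟩ := exists_subset_box s
      filter_upwards [eventually_ge_atTop N₀] with N hN using h0 N hN
  have hs : Summable f := by
    refine summable_of_sum_le hf (c := a) fun s => ?_
    obtain ⟨N₀, h0⟩ := exists_subset_box s
    refine ge_of_tendsto h ?_
    filter_upwards [eventually_ge_atTop N₀] with N hN
    exact Finset.sum_le_sum_of_subset_of_nonneg (h0 N hN) fun k _ _ => hf k
  rw [← tendsto_nhds_unique (hs.hasSum.comp hbox) h]
  exact hs.hasSum

/-- The norm identity behind the isometric dilation of a Brehmer tuple. -/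
theorem hasSum_norm_sq_defect {G : Type*} [NormedAddCommGroup G] [InnerProductSpace ℂ G]
    {D : H →L[ℂ] G}
    (hD : ∀ x, ‖D x‖ ^ 2 =
      ∑ F : Finset (Fin n), (-1) ^ F.card * ‖((tupleProd T hT F)†) x‖ ^ 2)
    (hc : ∀ i, ‖T i‖ ≤ 1) (hp : ∀ i, IsPureOperator (T i)) (x : H) :
    HasSum (fun k => ‖D (((tuplePow T hT k)†) x)‖ ^ 2) (‖x‖ ^ 2) := by
  refine hasSum_of_tendsto_box (fun _ => sq_nonneg _) ?_
  simp_rw [sum_box_eq hD]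
  -- The limit is taken separately for each `F`: only `F = ∅` contributes, since all other terms
  -- vanish by purity.
  have h1 : ‖x‖ ^ 2 = ∑ F : Finset (Fin n), if F = ∅ then ‖x‖ ^ 2 else 0 := by simp
  rw [h1]
  refine tendsto_finsetSum _ fun F _ => ?_
  rcases F.eq_empty_or_nonempty with rfl | hF
  · have h0 : ∀ N : ℕ, (fun i : Fin n => if i ∈ (∅ : Finset (Fin n)) then N else 0) = 0 := by
      intro N; ext; simp
    simp only [h0, tuplePow_zero, Finset.card_empty, pow_zero, one_mul, if_true]
    have : ((1 : H →L[ℂ] H)†) = 1 := star_one _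
    simp [this]
  · rw [if_neg hF.ne_empty]
    have := ((tendsto_adjoint_tuplePow (hT := hT) hc hp hF x).norm.pow 2).const_mul
      ((-1 : ℝ) ^ F.card)
    simpa using this

end TuplePow

section TupleProd

variable {n : ℕ} {H : Type*} [NormedAddCommGroup H] [InnerProductSpace ℂ H]
  {T : Fin n → H →L[ℂ] H} {hT : ∀ i j, Commute (T i) (T j)}

theorem commute_tupleProd {X : H →L[ℂ] H} {F : Finset (Fin n)} (h : ∀ i ∈ F, Commute X (T i)) :
    Commute X (tupleProd T hT F) :=
  Finset.noncommProd_commute _ _ _ _ h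

theorem tupleProd_insert {i : Fin n} {F : Finset (Fin n)} (hi : i ∉ F) :
    tupleProd T hT (insert i F) = T i * tupleProd T hT F :=
  Finset.noncommProd_insert_of_notMem _ _ _ _ hi

theorem tupleProd_empty : tupleProd T hT ∅ = 1 := rfl

end TupleProd

/-! ### The alternating defect operator and its quadratic form. -/

section Defect

variable {n : ℕ} {H : Type*} [NormedAddCommGroup H] [InnerProductSpace ℂ H] [CompleteSpace H]

/-- The defect operator `∑_F (-1)^|F| T_F T_F*` of a commuting tuple. -/
def defectOp (T : Fin n → H →L[ℂ] H) (hT : ∀ i j, Commute (T i) (T j)) : H →L[ℂ] H :=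
  ∑ F : Finset (Fin n), (-1 : ℂ) ^ F.card •
    (tupleProd T hT F * ContinuousLinearMap.adjoint (tupleProd T hT F))

variable {T : Fin n → H →L[ℂ] H} {hT : ∀ i j, Commute (T i) (T j)}

theorem defectOp_apply (x : H) : defectOp T hT x =
    ∑ F : Finset (Fin n), (-1 : ℂ) ^ F.card • tupleProd T hT F (((tupleProd T hT F)†) x) := by
  simp [defectOp]

theorem inner_defectOp_self (x : H) : ⟪defectOp T hT x, x⟫_ℂ =
    ((∑ F : Finset (Fin n), (-1) ^ F.card * ‖((tupleProd T hT F)†) x‖ ^ 2 : ℝ) : ℂ) := by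
  rw [defectOp_apply, sum_inner, Complex.ofReal_sum]
  refine Finset.sum_congr rfl fun F _ => ?_
  rw [inner_smul_left, ← ContinuousLinearMap.adjoint_inner_right, inner_self_eq_norm_sq_to_K]
  simp

theorem isPositive_defectOp (h : ∀ x, 0 ≤ ∑ F : Finset (Fin n), (-1 : ℝ) ^ F.card *
    ‖((tupleProd T hT F)†) x‖ ^ 2) : (defectOp T hT).IsPositive := by
  rw [ContinuousLinearMap.isPositive_iff_complex]
  intro x
  rw [inner_defectOp_self]
  exact ⟨congrArg _ (Complex.ofReal_re _), (h x).trans_eq (Complex.ofReal_re _).symm⟩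

theorem adjoint_mul (A B : H →L[ℂ] H) : (A * B)† = B† * A† := star_mul A B

end Defect

/-! ### Doubly commuting pure isometries and their wandering subspace. -/

/-- A commuting tuple of pure isometries such that `R_i* R_j = R_j R_i*` for `i ≠ j`. -/
structure IsDoublyCommutingShift {n : ℕ} {S : Type*} [NormedAddCommGroup S]
    [InnerProductSpace ℂ S] [CompleteSpace S] (R : Fin n → S →L[ℂ] S) : Prop where
  commute : ∀ i j, Commute (R i) (R j)
  norm_apply : ∀ i x, ‖R i x‖ = ‖x‖
  adjoint_commute : ∀ i j, i ≠ j → Commute ((R i)†) (R j)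
  pure : ∀ i, IsPureOperator (R i)

/-- The wandering subspace `⋂ i, ker R_i*`. -/
def wanderingSubspace {n : ℕ} {S : Type*} [NormedAddCommGroup S]
    [InnerProductSpace ℂ S] [CompleteSpace S] (R : Fin n → S →L[ℂ] S) : Submodule ℂ S :=
  ⨅ i, LinearMap.ker ((R i)†).toLinearMap

theorem mem_wanderingSubspace {n : ℕ} {S : Type*} [NormedAddCommGroup S]
    [InnerProductSpace ℂ S] [CompleteSpace S] {R : Fin n → S →L[ℂ] S} {x : S} :
    x ∈ wanderingSubspace R ↔ ∀ i, ((R i)†) x = 0 := by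
  simp [wanderingSubspace]

instance {n : ℕ} {S : Type*} [NormedAddCommGroup S]
    [InnerProductSpace ℂ S] [CompleteSpace S] (R : Fin n → S →L[ℂ] S) :
    CompleteSpace (wanderingSubspace R) := by
  refine IsClosed.completeSpace_coe (hs := ?_)
  have : (wanderingSubspace R : Set S) = ⋂ i, (fun x => ((R i)†) x) ⁻¹' {0} := by
    ext x; simp [mem_wanderingSubspace]
  rw [this]
  exact isClosed_iInter fun i => isClosed_singleton.preimage ((R i)†).continuous

namespace IsDoublyCommutingShift

variable {n : ℕ} {S : Type*} [NormedAddCommGroup S] [InnerProductSpace ℂ S] [CompleteSpace S]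
  {R : Fin n → S →L[ℂ] S}

theorem norm_le_one (h : IsDoublyCommutingShift R) (i : Fin n) : ‖R i‖ ≤ 1 :=
  ContinuousLinearMap.opNorm_le_bound _ zero_le_one fun x => by rw [h.norm_apply, one_mul]

theorem adjoint_mul_self (h : IsDoublyCommutingShift R) (i : Fin n) : (R i)† * R i = 1 :=
  (ContinuousLinearMap.norm_map_iff_adjoint_comp_self _).1 (h.norm_apply i)

theorem adjoint_apply_self (h : IsDoublyCommutingShift R) (i : Fin n) (x : S) :
    ((R i)†) (R i x) = x :=
  DFunLike.congr_fun (h.adjoint_mul_self i) x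

/-- The subsets not containing `i` are paired with their unions with `{i}`. After multiplication by
`R_i*`, the relation `R_i* R_i = 1` and double commutation make the two terms of a pair equal up to
opposite signs. -/
theorem adjoint_mul_defectOp (h : IsDoublyCommutingShift R) (i : Fin n) :
    (R i)† * defectOp R h.commute = 0 := by
  have key : ∀ F : Finset (Fin n), i ∉ F →
      (R i)† * (tupleProd R h.commute (insert i F) * (tupleProd R h.commute (insert i F))†) =
        (R i)† * (tupleProd R h.commute F * (tupleProd R h.commute F)†) := by
    intro F hF
    have h1 : Commute ((R i)†) (tupleProd R h.commute F) :=
      commute_tupleProd fun j hj => h.adjoint_commute i j (by rintro rfl; exact hF hj)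
    have h2 : Commute (R i) (tupleProd R h.commute F) :=
      commute_tupleProd fun j _ => h.commute i j
    have h3 : (R i * tupleProd R h.commute F)† = (R i)† * (tupleProd R h.commute F)† := by
      rw [h2.eq, adjoint_mul]
    rw [tupleProd_insert hF, h3, mul_assoc, ← mul_assoc _ (R i), h.adjoint_mul_self, one_mul,
      ← mul_assoc, ← h1.eq, mul_assoc]
  have huniv : (Finset.univ : Finset (Finset (Fin n))) =
      (insert i (Finset.univ.erase i)).powerset := by
    rw [Finset.insert_erase (Finset.mem_univ i), Finset.powerset_univ]
  unfold defectOp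
  rw [huniv, Finset.sum_powerset_insert (Finset.notMem_erase _ _), ← Finset.sum_add_distrib,
    Finset.mul_sum]
  refine Finset.sum_eq_zero fun F hF => ?_
  have hi : i ∉ F := fun hi => Finset.notMem_erase i _ (Finset.mem_powerset.1 hF hi)
  rw [mul_add, mul_smul_comm, mul_smul_comm, key F hi, Finset.card_insert_of_notMem hi, ← add_smul,
    pow_succ]
  simp

theorem adjoint_tupleProd_apply_eq_zero {T : Fin n → S →L[ℂ] S}
    {hT : ∀ i j, Commute (T i) (T j)} {x : S} (hx : ∀ i, ((T i)†) x = 0) {F : Finset (Fin n)}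
    (hF : F.Nonempty) : ((tupleProd T hT F)†) x = 0 := by
  obtain ⟨i, hi⟩ := hF
  rw [← Finset.insert_erase hi, tupleProd_insert (Finset.notMem_erase _ _), adjoint_mul,
    mul_apply_eq_comp, hx, map_zero]

/-- Every term with `F` nonempty starts by applying some `T_i*` to `x`, so only `F = ∅` survives. -/
theorem defectOp_apply_of_mem {T : Fin n → S →L[ℂ] S}
    {hT : ∀ i j, Commute (T i) (T j)} {x : S} (hx : ∀ i, ((T i)†) x = 0) :
    defectOp T hT x = x := by
  rw [defectOp_apply, Finset.sum_eq_single ∅]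
  · have : ((1 : S →L[ℂ] S)†) = 1 := star_one _
    simp [tupleProd_empty, this]
  · intro F _ hF
    rw [adjoint_tupleProd_apply_eq_zero hx (Finset.nonempty_iff_ne_empty.2 hF)]
    simp
  · simp

theorem isSelfAdjoint_defectOp (T : Fin n → S →L[ℂ] S) (hT : ∀ i j, Commute (T i) (T j)) :
    IsSelfAdjoint (defectOp T hT) := by
  unfold defectOp
  refine isSelfAdjoint_sum _ fun F _ => ?_
  refine IsSelfAdjoint.smul ?_ (IsSelfAdjoint.mul_star_self _)
  simp [IsSelfAdjoint]

/-- The defect operator of a doubly commuting tuple of isometries is the projection onto the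
wandering subspace. -/
theorem defectOp_eq (h : IsDoublyCommutingShift R) (x : S) :
    defectOp R h.commute x = ((wanderingSubspace R).orthogonalProjectionOnto x : S) := by
  have : (wanderingSubspace R).starProjection x = defectOp R h.commute x := by
    refine Submodule.eq_starProjection_of_mem_of_inner_eq_zero ?_ fun w hw => ?_
    · rw [mem_wanderingSubspace]
      exact fun i => DFunLike.congr_fun (h.adjoint_mul_defectOp i) x
    · have h1 := ContinuousLinearMap.adjoint_inner_left (defectOp R h.commute) w x
      rw [(isSelfAdjoint_defectOp R h.commute).adjoint_eq,
        defectOp_apply_of_mem (mem_wanderingSubspace.1 hw)] at h1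
      rw [inner_sub_left, h1, sub_self]
  rw [← this, Submodule.starProjection_apply]

/-- This puts the projection onto the wandering subspace in the role of `D` in the norm identity,
which is how the Wold decomposition becomes a case of the Brehmer dilation. -/
theorem norm_sq_projection (h : IsDoublyCommutingShift R) (x : S) :
    ‖(wanderingSubspace R).orthogonalProjectionOnto x‖ ^ 2 =
      ∑ F : Finset (Fin n), (-1) ^ F.card * ‖((tupleProd R h.commute F)†) x‖ ^ 2 := by
  have h1 := inner_defectOp_self (hT := h.commute) x
  rw [h.defectOp_eq] at h1
  have h2 : ⟪((wanderingSubspace R).orthogonalProjectionOnto x : S), x⟫_ℂ =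
      ((‖(wanderingSubspace R).orthogonalProjectionOnto x‖ ^ 2 : ℝ) : ℂ) := by
    rw [← Submodule.inner_orthogonalProjectionOnto_eq_of_mem_left, inner_self_eq_norm_sq_to_K]
    simp
  exact Complex.ofReal_injective (h2.symm.trans h1)

end IsDoublyCommutingShift

/-! ### Compressions to co-invariant subspaces and products of their defects. -/

section Coisometric

variable {n : ℕ} {H K : Type*} [NormedAddCommGroup H] [InnerProductSpace ℂ H] [CompleteSpace H]
  [NormedAddCommGroup K] [InnerProductSpace ℂ K] [CompleteSpace K]
  {T : Fin n → H →L[ℂ] H} {hT : ∀ i j, Commute (T i) (T j)}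
  {M : Fin n → K →L[ℂ] K} {hM : ∀ i j, Commute (M i) (M j)}

theorem map_adjoint_tupleProd {W : H →L[ℂ] K} (hW : ∀ i x, W (((T i)†) x) = ((M i)†) (W x))
    (F : Finset (Fin n)) (x : H) :
    W (((tupleProd T hT F)†) x) = ((tupleProd M hM F)†) (W x) := by
  induction F using Finset.induction_on generalizing x with
  | empty =>
    have h1 : ((1 : H →L[ℂ] H)†) = 1 := star_one _
    have h2 : ((1 : K →L[ℂ] K)†) = 1 := star_one _
    simp [tupleProd_empty, h1, h2]
  | insert a F ha ih =>
    simp only [tupleProd_insert ha, adjoint_mul, mul_apply_eq_comp, ih, hW]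

/-- The compression of a doubly commuting tuple of pure isometries to a co-invariant subspace is
a Brehmer tuple. -/
theorem IsDoublyCommutingShift.isBrehmer (h : IsDoublyCommutingShift M) (W : H →ₗᵢ[ℂ] K)
    (hW : ∀ i x, W (((T i)†) x) = ((M i)†) (W x)) : IsBrehmer T hT := by
  refine ⟨fun i x => ?_, isPositive_defectOp fun x => ?_⟩
  · have h1 : ∀ m : ℕ, W ((((T i)†) ^ m) x) = (((M i)†) ^ m) (W x) := by
      intro m
      induction m with
      | zero => rfl
      | succ m ih => simp only [pow_succ', mul_apply_eq_comp, hW, ih]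
    have h2 := h.pure i (W x)
    rw [tendsto_zero_iff_norm_tendsto_zero] at h2 ⊢
    refine h2.congr fun m => ?_
    rw [← h1, W.norm_map]
  · have h1 : ∀ F, ‖((tupleProd T hT F)†) x‖ = ‖((tupleProd M h.commute F)†) (W x)‖ := by
      intro F
      rw [← W.norm_map]
      congr 1
      exact map_adjoint_tupleProd (W := W.toContinuousLinearMap) hW F x
    simp_rw [h1]
    -- Transported by `W`, the alternating sum is the squared norm of a projection of `W x`.
    rw [← h.norm_sq_projection]
    positivity

/-- Since `C* C` and `C` have the same kernel, the left factor `A*` can be cancelled, leaving `A B*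
B = 0`. Passing to adjoints, cancelling `B*` in the same way and returning to adjoints gives `A B* =
0`. -/
theorem adjoint_comp_self_mul_eq_zero_iff {A B : H →L[ℂ] K} :
    (A† ∘L A) * (B† ∘L B) = 0 ↔ ∀ x, A ((B†) x) = 0 := by
  have key : ∀ (C : H →L[ℂ] K) (x : H), (C†) (C x) = 0 → C x = 0 := by
    intro C x hx
    have := ContinuousLinearMap.adjoint_inner_left C x (C x)
    rw [hx, inner_zero_left] at this
    exact inner_self_eq_zero.1 this.symm
  constructor
  · intro h
    have h1 : ∀ x, A ((B†) (B x)) = 0 := fun x => key A _ (DFunLike.congr_fun h x)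
    have h2 : ∀ x, (B†) (B ((A†) x)) = 0 := by
      intro x
      refine ext_inner_right ℂ fun y => ?_
      rw [inner_zero_left, ContinuousLinearMap.adjoint_inner_left,
        ← ContinuousLinearMap.adjoint_inner_right, ContinuousLinearMap.adjoint_inner_left, h1,
        inner_zero_right]
    intro x
    refine ext_inner_right ℂ fun y => ?_
    rw [inner_zero_left, ← ContinuousLinearMap.adjoint_inner_right,
      ContinuousLinearMap.adjoint_inner_left, key B _ (h2 y), inner_zero_right]
  · intro h
    ext x
    simp [h]

/-- If `T` is the compression of isometries `M i` to the co-invariant range of an isometry `W`, the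
defect operators `1 - T_i* T_i` have zero products if and only if the compressions of the `M i` from
`ran W` to its complement have zero products with the adjoints. -/
theorem defect_mul_defect_eq_zero_iff (W : H →ₗᵢ[ℂ] K)
    (hW : ∀ i x, W (((T i)†) x) = ((M i)†) (W x)) (hM : ∀ i x, ((M i)†) (M i x) = x)
    (i j : Fin n) :
    (1 - (T i)† * T i) * (1 - (T j)† * T j) = 0 ↔
      ∀ x, M i (W ((W.toContinuousLinearMap†) (((M j)†) x))) -
          M i (((M j)†) (W ((W.toContinuousLinearMap†) x))) =
        W ((W.toContinuousLinearMap†) (M i (W ((W.toContinuousLinearMap†) (((M j)†) x))) -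
          M i (((M j)†) (W ((W.toContinuousLinearMap†) x))))) := by
  set V : H →L[ℂ] K := W.toContinuousLinearMap with hV
  have hVW : ∀ x, W x = V x := fun _ => rfl
  have hVV : ∀ x, (V†) (V x) = x := fun x =>
    DFunLike.congr_fun ((ContinuousLinearMap.norm_map_iff_adjoint_comp_self V).1 W.norm_map) x
  simp only [hVW] at hW ⊢
  have hT1 : ∀ i x, (V†) (M i x) = T i ((V†) x) := by
    intro i x
    refine ext_inner_right ℂ fun y => ?_
    rw [ContinuousLinearMap.adjoint_inner_left, ← ContinuousLinearMap.adjoint_inner_right,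
      ← ContinuousLinearMap.adjoint_inner_right (T i), ContinuousLinearMap.adjoint_inner_left, hW]
  -- As `V* M_i = T_i V*`, this is `(1 - V V*) M_i V`, the part of `M_i` leading from the range of
  -- `V` to its complement. Because `M_i` and `V` are isometric, `B_i* B_i = 1 - T_i* T_i`. The
  -- displayed condition is `B_i B_j* x = 0` written out with `V T_j* = M_j* V`.
  set B : Fin n → H →L[ℂ] K := fun i => M i ∘L V - V ∘L T i with hB
  have hBa : ∀ i x, ((B i)†) x = (V†) (((M i)†) x) - ((T i)†) ((V†) x) := by
    intro i x
    simp [hB, ContinuousLinearMap.adjoint_comp]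
  have hBB : ∀ i, (B i)† ∘L B i = 1 - (T i)† * T i := by
    intro i
    ext x
    have e1 : (V†) (((M i)†) (V (T i x))) = ((T i)†) (T i x) := by rw [← hW, hVV]
    simp only [ContinuousLinearMap.comp_apply, hBa]
    simp only [hB, sub_apply, ContinuousLinearMap.comp_apply, map_sub, hM, hVV,
      e1, hT1, one_apply_eq_self, mul_apply_eq_comp]
    abel
  rw [← hBB, ← hBB, adjoint_comp_self_mul_eq_zero_iff]
  refine forall_congr' fun x => ?_
  rw [hBa]
  have e2 : ∀ y, (V†) (((M j)†) (V y)) = ((T j)†) y := fun y => by rw [← hW, hVV]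
  simp only [hB, sub_apply, ContinuousLinearMap.comp_apply, map_sub, hT1, sub_eq_zero, e2, hW]
  simp only [hVV]
  rw [sub_eq_sub_iff_sub_eq_sub]

end Coisometric

/-! ### Geometric series and orthogonality of monomials on the torus. -/

section Monomials

variable {n : ℕ}

/-- Induction on the number of variables, splitting off the first. The two conclusions travel
together because multiplying the series requires absolute convergence. -/
theorem summable_and_hasSum_prod_pow : ∀ (n : ℕ) (x : Fin n → ℂ), (∀ i, ‖x i‖ < 1) →
    (Summable fun k : Fin n → ℕ => ‖∏ i, x i ^ k i‖) ∧
      HasSum (fun k : Fin n → ℕ => ∏ i, x i ^ k i) (∏ i, (1 - x i)⁻¹) := by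
  intro n
  induction n with
  | zero =>
    intro x _
    exact ⟨(hasSum_fintype _).summable, by simp⟩
  | succ n ih =>
    intro x hx
    obtain ⟨h1, h2⟩ := ih (fun i => x i.succ) (fun i => hx i.succ)
    have h3 : HasSum (fun m : ℕ => x 0 ^ m) (1 - x 0)⁻¹ := hasSum_geometric_of_norm_lt_one (hx 0)
    have h4 : Summable fun m : ℕ => ‖x 0 ^ m‖ := by
      simpa using summable_geometric_of_lt_one (norm_nonneg _) (hx 0)
    have he : ∀ p : ℕ × (Fin n → ℕ), ∏ i, x i ^ (Fin.consEquiv (fun _ : Fin (n + 1) => ℕ) p) i =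
        x 0 ^ p.1 * ∏ i : Fin n, x i.succ ^ p.2 i := by
      intro p
      simp [Fin.prod_univ_succ, Fin.consEquiv_apply]
    constructor
    · rw [← (Fin.consEquiv (fun _ : Fin (n + 1) => ℕ)).summable_iff]
      refine (h4.mul_norm h1).congr fun p => ?_
      simp only [Function.comp_apply, he]
    · rw [← (Fin.consEquiv (fun _ : Fin (n + 1) => ℕ)).hasSum_iff, Fin.prod_univ_succ]
      have h5 := HasSum.mul (f := fun m : ℕ => x 0 ^ m)
        (g := fun k : Fin n → ℕ => ∏ i, x (Fin.succ i) ^ k i) h3 h2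
        (h4.mul_norm h1).of_norm
      refine Eq.mp (congrArg (fun F => HasSum F _) (funext fun p => ?_)) h5
      exact (he p).symm

theorem summable_norm_prod_pow {x : Fin n → ℂ} (hx : ∀ i, ‖x i‖ < 1) :
    Summable fun k : Fin n → ℕ => ‖∏ i, x i ^ k i‖ :=
  (summable_and_hasSum_prod_pow n x hx).1

theorem hasSum_prod_pow {x : Fin n → ℂ} (hx : ∀ i, ‖x i‖ < 1) :
    HasSum (fun k : Fin n → ℕ => ∏ i, x i ^ k i) (∏ i, (1 - x i)⁻¹) :=
  (summable_and_hasSum_prod_pow n x hx).2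

theorem norm_prod_pow_le_one {z : Fin n → ℂ} (hz : ∀ i, ‖z i‖ ≤ 1) (k : Fin n → ℕ) :
    ‖∏ i, z i ^ k i‖ ≤ 1 := by
  rw [norm_prod]
  refine Finset.prod_le_one (fun _ _ => norm_nonneg _) fun i _ => ?_
  rw [norm_pow]
  exact pow_le_one₀ (norm_nonneg _) (hz i)

theorem integral_conj_toCircle_pow_mul {a b : ℕ} (hab : a ≠ b) :
    ∫ s : UnitAddCircle, (starRingEnd ℂ) ((AddCircle.toCircle s : ℂ) ^ a) *
      (AddCircle.toCircle s : ℂ) ^ b = 0 := by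
  have h1 : ∀ s : UnitAddCircle, (starRingEnd ℂ) ((AddCircle.toCircle s : ℂ) ^ a) *
      (AddCircle.toCircle s : ℂ) ^ b = fourier ((b : ℤ) - a) s := by
    intro s
    rw [sub_eq_add_neg, add_comm, fourier_add, fourier_neg, fourier_apply, fourier_apply,
      natCast_zsmul, natCast_zsmul, AddCircle.toCircle_nsmul, AddCircle.toCircle_nsmul,
      Circle.coe_pow, Circle.coe_pow]
  simp_rw [h1]
  -- A nontrivial character changes sign under a suitable translation, so its integral equals its
  -- own negative.
  refine integral_eq_zero_of_add_right_eq_neg (fourier_add_half_inv_index ?_ one_pos)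
  omega

theorem integral_conj_torusPoint_mul (k l : Fin n → ℕ) :
    ∫ t : UnitAddTorus (Fin n), (starRingEnd ℂ) (∏ i, torusPoint t i ^ k i) *
      ∏ i, torusPoint t i ^ l i = if k = l then 1 else 0 := by
  simp_rw [map_prod, ← Finset.prod_mul_distrib]
  refine (integral_fintype_prod_volume_eq_prod (fun i (s : UnitAddCircle) =>
    (starRingEnd ℂ) ((AddCircle.toCircle s : ℂ) ^ k i) * (AddCircle.toCircle s : ℂ) ^ l i)).trans ?_
  split_ifs with h
  · subst h
    refine Finset.prod_eq_one fun i _ => ?_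
    have h1 : ∀ s : UnitAddCircle, (starRingEnd ℂ) ((AddCircle.toCircle s : ℂ) ^ k i) *
        (AddCircle.toCircle s : ℂ) ^ k i = 1 := by
      intro s
      rw [Complex.conj_mul', norm_pow, Circle.norm_coe]
      simp
    simp_rw [h1]
    simp
  · obtain ⟨i, hi⟩ := Function.ne_iff.1 h
    exact Finset.prod_eq_zero (Finset.mem_univ i) (integral_conj_toCircle_pow_mul hi)

end Monomials

/-! ### Monomials in the Hardy space and its inner product. -/

namespace HardySpace

variable {n : ℕ} {E : Type*} [NormedAddCommGroup E] [InnerProductSpace ℂ E]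

theorem add_apply (f g : HardySpace n E) (z : Fin n → ℂ) : (f + g) z = f z + g z := rfl

theorem smul_apply (c : ℂ) (f : HardySpace n E) (z : Fin n → ℂ) : (c • f) z = c • f z := rfl

theorem continuous_slice_coe (f : HardySpace n E) {r : ℝ} (hr : r ∈ Ico (0 : ℝ) 1) :
    Continuous fun t : UnitAddTorus (Fin n) => f ((r : ℂ) • torusPoint t) :=
  continuous_slice f.2.1 hr

/-- The indicator implements the convention that Hardy functions are extended by zero. The means are
at most `C²` because the torus has total mass one. -/
theorem mem_hardySubmodule_of_bounded {f : (Fin n → ℂ) → E}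
    (hf : DifferentiableOn ℂ f (polydisc n)) {C : ℝ} (hC : ∀ z ∈ polydisc n, ‖f z‖ ≤ C) :
    (polydisc n).indicator f ∈ hardySubmodule n E := by
  have hC0 : 0 ≤ C := (norm_nonneg _).trans (hC 0 fun i => by simp)
  have hd : DifferentiableOn ℂ ((polydisc n).indicator f) (polydisc n) :=
    hf.congr fun z hz => indicator_of_mem hz f
  refine ⟨hd, fun z hz => indicator_of_notMem hz f, C ^ 2, ?_⟩
  rintro _ ⟨r, rfl⟩
  have h1 : sqMean ((polydisc n).indicator f) r ≤ ∫ _ : UnitAddTorus (Fin n), C ^ 2 := by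
    refine integral_mono (integrable_sqMean hd r.2) (integrable_const _) fun t => ?_
    have hm : ((r : ℝ) : ℂ) • torusPoint t ∈ polydisc n :=
      smul_torusPoint_mem (by simpa [abs_of_nonneg r.2.1] using r.2.2) t
    simp only [indicator_of_mem hm]
    gcongr
    exact hC _ hm
  simpa using h1

theorem differentiable_prod_pow (k : Fin n → ℕ) :
    Differentiable ℂ (fun z : Fin n → ℂ => ∏ i, z i ^ k i) := by
  fun_prop

/-- The function `z ↦ z^k e`. -/
def monomialFun (k : Fin n → ℕ) (e : E) : HardySpace n E :=
  ⟨(polydisc n).indicator fun z => (∏ i, z i ^ k i) • e,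
    mem_hardySubmodule_of_bounded (C := ‖e‖)
      ((differentiable_prod_pow k).smul_const e).differentiableOn fun z hz => by
        rw [norm_smul]
        exact mul_le_of_le_one_left (norm_nonneg _) (norm_prod_pow_le_one (fun i => (hz i).le) k)⟩

theorem monomialFun_apply (k : Fin n → ℕ) (e : E) {z : Fin n → ℂ} (hz : z ∈ polydisc n) :
    monomialFun k e z = (∏ i, z i ^ k i) • e :=
  indicator_of_mem hz fun z : Fin n → ℂ => (∏ i, z i ^ k i) • e

variable [CompleteSpace E]

/-- The inner product of `H²` is the limit of the inner products in `L²` of the tori of radius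
`r < 1`. -/
theorem tendsto_integral_inner (f g : HardySpace n E) :
    Tendsto (fun r : Ico (0 : ℝ) 1 => ∫ t : UnitAddTorus (Fin n),
      ⟪f (((r : ℝ) : ℂ) • torusPoint t), g (((r : ℝ) : ℂ) • torusPoint t)⟫_ℂ)
      atTop (𝓝 ⟪f, g⟫_ℂ) := by
  -- The inner product of the Hardy space comes from the norm by polarization. Polarizing pointwise
  -- in `E` as well reduces the claim to convergence of the square means of four functions.
  rw [inner_eq_sum_norm_sq_div_four f g]
  have hc : ∀ h : HardySpace n E, Tendsto (fun r : Ico (0 : ℝ) 1 => ((sqMean h r : ℝ) : ℂ)) atTop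
      (𝓝 ((‖h‖ : ℂ) ^ 2)) := by
    intro h
    have := (Complex.continuous_ofReal.tendsto _).comp (tendsto_sqMean h)
    simpa [Function.comp_def] using this
  have h1 := ((((hc (f + g)).sub (hc (f - g))).add (((hc (f - RCLike.I (K := ℂ) • g)).sub
    (hc (f + RCLike.I (K := ℂ) • g))).mul_const (RCLike.I (K := ℂ)))).div_const 4)
  refine h1.congr fun r => ?_
  have hi : ∀ h : HardySpace n E, Integrable (fun t : UnitAddTorus (Fin n) =>
      ((‖h (((r : ℝ) : ℂ) • torusPoint t)‖ : ℂ)) ^ 2) := by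
    intro h
    refine integrable_of_cont ?_
    exact (Complex.continuous_ofReal.comp (continuous_slice_coe h r.2).norm).pow 2
  have hs : ∀ h : HardySpace n E, ((sqMean h r : ℝ) : ℂ) = ∫ t : UnitAddTorus (Fin n),
      ((‖h (((r : ℝ) : ℂ) • torusPoint t)‖ : ℂ)) ^ 2 := by
    intro h
    rw [sqMean, ← integral_complex_ofReal]
    simp
  have hi2 : ∀ h h' : HardySpace n E, Integrable (fun t : UnitAddTorus (Fin n) =>
      ((‖h (((r : ℝ) : ℂ) • torusPoint t)‖ : ℂ)) ^ 2 -
        ((‖h' (((r : ℝ) : ℂ) • torusPoint t)‖ : ℂ)) ^ 2) := fun h h' => (hi h).sub (hi h')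
  simp only [hs]
  rw [← integral_sub (hi _) (hi _), ← integral_sub (hi _) (hi _), ← integral_mul_const,
    ← integral_add (hi2 _ _) ((hi2 _ _).mul_const _), ← integral_div]
  refine integral_congr_ae (Eventually.of_forall fun t => ?_)
  exact (inner_eq_sum_norm_sq_div_four (f (((r : ℝ) : ℂ) • torusPoint t))
    (g (((r : ℝ) : ℂ) • torusPoint t))).symm

/-- On the torus of radius `r`, orthogonality of characters gives `r^(|k|+|l|) ⟪e, e'⟫` for `k = l`
and zero otherwise; then `r` tends to one. -/
theorem inner_monomialFun (k l : Fin n → ℕ) (e e' : E) :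
    ⟪monomialFun k e, monomialFun l e'⟫_ℂ = if k = l then ⟪e, e'⟫_ℂ else 0 := by
  refine tendsto_nhds_unique (tendsto_integral_inner _ _) ?_
  have h1 : ∀ r : Ico (0 : ℝ) 1, ∫ t : UnitAddTorus (Fin n),
      ⟪monomialFun k e (((r : ℝ) : ℂ) • torusPoint t),
        monomialFun l e' (((r : ℝ) : ℂ) • torusPoint t)⟫_ℂ =
      ((r : ℝ) : ℂ) ^ (∑ i, k i + ∑ i, l i) * if k = l then ⟪e, e'⟫_ℂ else 0 := by
    intro r
    have h2 : ∀ t : UnitAddTorus (Fin n), ⟪monomialFun k e (((r : ℝ) : ℂ) • torusPoint t),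
        monomialFun l e' (((r : ℝ) : ℂ) • torusPoint t)⟫_ℂ =
        (((r : ℝ) : ℂ) ^ (∑ i, k i + ∑ i, l i) * ⟪e, e'⟫_ℂ) *
          ((starRingEnd ℂ) (∏ i, torusPoint t i ^ k i) * ∏ i, torusPoint t i ^ l i) := by
      intro t
      have hm : ((r : ℝ) : ℂ) • torusPoint t ∈ polydisc n :=
        smul_torusPoint_mem (by simpa [abs_of_nonneg r.2.1] using r.2.2) t
      rw [monomialFun_apply _ _ hm, monomialFun_apply _ _ hm, inner_smul_left, inner_smul_right]
      simp only [Pi.smul_apply, smul_eq_mul, mul_pow, Finset.prod_mul_distrib,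
        Finset.prod_pow_eq_pow_sum, map_mul, map_pow, Complex.conj_ofReal, pow_add]
      ring
    simp_rw [h2]
    rw [integral_const_mul, integral_conj_torusPoint_mul]
    split_ifs <;> simp
  simp_rw [h1]
  have h3 : Tendsto (fun r : Ico (0 : ℝ) 1 => ((r : ℝ) : ℂ)) atTop (𝓝 1) := by
    have h4 : Tendsto (fun r : Ico (0 : ℝ) 1 => (r : ℝ)) atTop (𝓝 1) := by
      refine tendsto_atTop_isLUB (fun a b h => h) ?_
      rw [Subtype.range_coe]
      exact isLUB_Ico zero_lt_one
    simpa [Function.comp_def] using (Complex.continuous_ofReal.tendsto _).comp h4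
  simpa using (h3.pow (∑ i, k i + ∑ i, l i)).mul_const (if k = l then ⟪e, e'⟫_ℂ else 0)

/-- The isometric embedding `e ↦ z^k e` of `E` into `H²_E`. -/
def monomialIsometry (n : ℕ) (E : Type*) [NormedAddCommGroup E] [InnerProductSpace ℂ E]
    [CompleteSpace E] (k : Fin n → ℕ) : E →ₗᵢ[ℂ] HardySpace n E where
  toFun := monomialFun k
  map_add' e e' := HardySpace.ext fun z hz => by
    rw [add_apply, monomialFun_apply _ _ hz, monomialFun_apply _ _ hz, monomialFun_apply _ _ hz,
      smul_add]
  map_smul' c e := HardySpace.ext fun z hz => by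
    rw [smul_apply, monomialFun_apply _ _ hz, monomialFun_apply _ _ hz, smul_comm]
    rfl
  norm_map' e := by
    have h := inner_monomialFun k k e e
    rw [if_pos rfl, inner_self_eq_norm_sq_to_K, inner_self_eq_norm_sq_to_K] at h
    have h' : ‖monomialFun k e‖ ^ 2 = ‖e‖ ^ 2 := by exact_mod_cast h
    exact (sq_eq_sq₀ (norm_nonneg _) (norm_nonneg _)).1 h'

theorem monomialIsometry_apply (k : Fin n → ℕ) (e : E) {z : Fin n → ℂ} (hz : z ∈ polydisc n) :
    monomialIsometry n E k e z = (∏ i, z i ^ k i) • e :=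
  monomialFun_apply k e hz

theorem inner_monomialIsometry (k l : Fin n → ℕ) (e e' : E) :
    ⟪monomialIsometry n E k e, monomialIsometry n E l e'⟫_ℂ = if k = l then ⟪e, e'⟫_ℂ else 0 :=
  inner_monomialFun k l e e'

theorem orthogonalFamily_monomialIsometry :
    OrthogonalFamily ℂ (fun _ : Fin n → ℕ => E) (monomialIsometry n E) :=
  fun k l hkl e e' => by rw [inner_monomialIsometry, if_neg hkl]

/-- Evaluation at `z` as a bounded operator on `H²_E`. -/
def evalCLM (n : ℕ) (E : Type*) [NormedAddCommGroup E] [InnerProductSpace ℂ E]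
    [CompleteSpace E] (z : Fin n → ℂ) : HardySpace n E →L[ℂ] E :=
  LinearMap.mkContinuousOfExistsBound
    { toFun := fun f => f z
      map_add' := fun _ _ => rfl
      map_smul' := fun _ _ => rfl }
    (by
      by_cases hz : z ∈ polydisc n
      · rw [polydisc_eq_ball, mem_ball_zero_iff] at hz
        obtain ⟨C, -, hC⟩ := exists_norm_apply_le (E := E) n (norm_nonneg z) hz
        exact ⟨C, fun f => hC f z fun i => norm_le_pi_norm z i⟩
      · exact ⟨0, fun f => by
          change ‖f z‖ ≤ _
          rw [f.2.2.1 z hz]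
          simp⟩)

@[simp] theorem evalCLM_apply (z : Fin n → ℂ) (f : HardySpace n E) : evalCLM n E z f = f z := rfl

end HardySpace

/-! ### Cauchy formula, Szegő kernel and density of the monomials. -/

namespace HardySpace

section Cauchy

variable {F : Type*} [NormedAddCommGroup F] [InnerProductSpace ℂ F]

theorem integral_cons_eq {n : ℕ} (g : UnitAddTorus (Fin (n + 1)) → F) :
    ∫ p : UnitAddCircle × UnitAddTorus (Fin n),
      g (Fin.cons p.1 p.2 : UnitAddTorus (Fin (n + 1)))
        ∂((volume : Measure UnitAddCircle).prod (volume : Measure (UnitAddTorus (Fin n)))) =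
      ∫ t, g t := by
  have h := (volume_preserving_piFinSuccAbove (fun _ : Fin (n + 1) => UnitAddCircle) 0).symm
  have h2 := h.integral_comp (MeasurableEquiv.measurableEmbedding _) g
  rw [← h2]
  simp only [MeasurableEquiv.piFinSuccAbove_symm_apply, Fin.insertNthEquiv_zero]
  rfl

theorem circle_sub_ne_zero {R : ℝ} {w : ℂ} (hw : ‖w‖ < R) (s : UnitAddCircle) :
    (R : ℂ) * AddCircle.toCircle s - w ≠ 0 := by
  intro h0
  rw [sub_eq_zero] at h0
  rw [← h0] at hw
  simp only [norm_mul, Complex.norm_real, Circle.norm_coe, mul_one, Real.norm_eq_abs] at hw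
  exact absurd hw (not_lt.2 (le_abs_self R))

theorem continuous_cauchyKernel {R : ℝ} {w : ℂ} (hw : ‖w‖ < R) :
    Continuous fun s : UnitAddCircle =>
      ((R : ℂ) * AddCircle.toCircle s) / ((R : ℂ) * AddCircle.toCircle s - w) := by
  have := @AddCircle.continuous_toCircle (1 : ℝ)
  exact Continuous.div (by fun_prop) (by fun_prop) (circle_sub_ne_zero hw)

variable [CompleteSpace F]

theorem circle_cauchy_formula {h : ℂ → F} (hh : DifferentiableOn ℂ h (Metric.ball 0 1)) {R : ℝ}
    (hR : R < 1) {w : ℂ} (hw : ‖w‖ < R) :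
    ∫ s : UnitAddCircle, (((R : ℂ) * AddCircle.toCircle s) /
      ((R : ℂ) * AddCircle.toCircle s - w)) • h ((R : ℂ) * AddCircle.toCircle s) = h w := by
  have hR0 : 0 < R := (norm_nonneg w).trans_lt hw
  have hD : DiffContOnCl ℂ h (Metric.ball 0 |R|) :=
    DifferentiableOn.diffContOnCl (hh.mono (by
      rw [abs_of_pos hR0, closure_ball _ hR0.ne']; exact Metric.closedBall_subset_ball hR))
  have h1 := hD.circleAverage_smul_div (w := w) (by simpa [abs_of_pos hR0] using hw)
  rw [circleAverage_eq_integral] at h1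
  simpa only [sub_zero] using h1

/-- The Cauchy integral formula on the polydisc. -/
theorem cauchy_formula {R : ℝ} (hR : R < 1) :
    ∀ (n : ℕ) (f : (Fin n → ℂ) → F), DifferentiableOn ℂ f (polydisc n) →
      ∀ w : Fin n → ℂ, 0 < R → (∀ i, ‖w i‖ < R) →
        ∫ t : UnitAddTorus (Fin n), (∏ i, ((R : ℂ) * torusPoint t i) /
          ((R : ℂ) * torusPoint t i - w i)) • f ((R : ℂ) • torusPoint t) = f w := by
  intro n
  induction n with
  | zero =>
    intro f _ w _ _
    simp only [Finset.univ_eq_empty, Finset.prod_empty, one_smul,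
      Subsingleton.elim _ w, integral_const, probReal_univ]
  | succ n ih =>
    intro f hf w hR0 hw
    have hRm : R ∈ Ico (0 : ℝ) 1 := ⟨hR0.le, hR⟩
    have hcons : ∀ (z : ℂ) (v : Fin n → ℂ), ‖z‖ < 1 → v ∈ polydisc n →
        (Fin.cons z v : Fin (n + 1) → ℂ) ∈ polydisc (n + 1) := by
      intro z v hz hv i
      refine Fin.cases ?_ (fun j => ?_) i
      · simpa using hz
      · simpa using hv j
    have hw0 : ‖w 0‖ < 1 := (hw 0).trans hR
    have hdc1 : ∀ z : ℂ, Differentiable ℂ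
        (fun v : Fin n → ℂ => (Fin.cons z v : Fin (n + 1) → ℂ)) := by
      intro z
      rw [differentiable_pi]
      intro i
      refine Fin.cases ?_ (fun j => ?_) i
      · simp
      · simp only [Fin.cons_succ]; fun_prop
    have hdc2 : ∀ v : Fin n → ℂ, Differentiable ℂ
        (fun z : ℂ => (Fin.cons z v : Fin (n + 1) → ℂ)) := by
      intro v
      rw [differentiable_pi]
      intro i
      refine Fin.cases ?_ (fun j => ?_) i
      · simp only [Fin.cons_zero]; fun_prop
      · simp
    have hf1 : DifferentiableOn ℂ (fun v : Fin n → ℂ => f (Fin.cons (w 0) v)) (polydisc n) :=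
      hf.comp (hdc1 _).differentiableOn fun v hv => hcons _ _ hw0 hv
    have h1 := ih _ hf1 (Fin.tail w) hR0 (fun i => hw i.succ)
    simp only [Fin.cons_self_tail] at h1
    have hτ : ∀ t : UnitAddTorus (Fin n), (R : ℂ) • torusPoint t ∈ polydisc n :=
      fun t => smul_torusPoint_mem (by simpa [abs_of_nonneg hRm.1] using hR) t
    have hcF := continuous_slice hf hRm
    have hcons2 : ∀ (s : UnitAddCircle) (t : UnitAddTorus (Fin n)),
        (R : ℂ) • torusPoint (Fin.cons s t : UnitAddTorus (Fin (n + 1))) =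
          Fin.cons ((R : ℂ) * AddCircle.toCircle s) ((R : ℂ) • torusPoint t) := by
      intro s t
      ext i
      refine Fin.cases ?_ (fun j => ?_) i
      · simp [torusPoint]
      · simp [torusPoint]
    set P : UnitAddTorus (Fin n) → ℂ := fun t => ∏ i : Fin n, ((R : ℂ) * torusPoint t i) /
      ((R : ℂ) * torusPoint t i - Fin.tail w i) with hP
    set C : UnitAddCircle → ℂ := fun s => ((R : ℂ) * AddCircle.toCircle s) /
      ((R : ℂ) * AddCircle.toCircle s - w 0) with hC
    have hcP : Continuous P := continuous_finsetProd _ fun i _ =>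
      (continuous_cauchyKernel (hw i.succ)).comp (continuous_apply i)
    have hcC : Continuous C := continuous_cauchyKernel (hw 0)
    set G : UnitAddCircle → UnitAddTorus (Fin n) → F := fun s t =>
      (P t * C s) • f ((R : ℂ) • torusPoint (Fin.cons s t : UnitAddTorus (Fin (n + 1)))) with hG
    have hcG : Continuous (fun p : UnitAddCircle × UnitAddTorus (Fin n) => G p.1 p.2) := by
      have : Continuous (fun p : UnitAddCircle × UnitAddTorus (Fin n) =>
          f ((R : ℂ) • torusPoint (Fin.cons p.1 p.2 : UnitAddTorus (Fin (n + 1))))) := by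
        refine hcF.comp (continuous_pi fun i => ?_)
        refine Fin.cases ?_ (fun j => ?_) i
        · simp only [Fin.cons_zero]; fun_prop
        · simp only [Fin.cons_succ]; fun_prop
      exact ((hcP.comp continuous_snd).mul (hcC.comp continuous_fst)).smul this
    have hIG := integrable_of_cont
      (μ := (volume : Measure UnitAddCircle).prod (volume : Measure (UnitAddTorus (Fin n)))) hcG
    -- The one-variable formula in the first coordinate, with the other coordinates held on the
    -- torus. Inserting it into the formula for the tail of `w` and applying Fubini gives the
    -- formula in `n + 1` variables.
    have h2 : ∀ t : UnitAddTorus (Fin n),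
        P t • f (Fin.cons (w 0) ((R : ℂ) • torusPoint t)) = ∫ s : UnitAddCircle, G s t := by
      intro t
      have hd : DifferentiableOn ℂ (fun z : ℂ => f (Fin.cons z ((R : ℂ) • torusPoint t)))
          (Metric.ball 0 1) :=
        hf.comp (hdc2 _).differentiableOn fun z hz => hcons _ _ (by simpa using hz) (hτ t)
      have h3 := circle_cauchy_formula hd hR (hw 0)
      simp only [hG, mul_smul, hcons2]
      rw [integral_smul, h3]
    have e1 := integral_integral_swap (f := G) hIG
    have e2 := integral_integral (f := G) hIG
    have e3 := integral_cons_eq (n := n) (fun t => (∏ i, ((R : ℂ) * torusPoint t i) /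
          ((R : ℂ) * torusPoint t i - w i)) • f ((R : ℂ) • torusPoint t))
    refine e3.symm.trans (Eq.trans ?_ h1)
    refine Eq.trans ?_ (integral_congr_ae (Eventually.of_forall fun t => (h2 t).symm))
    rw [← e1, e2]
    congr 1
    ext p
    simp only [hG, hP, hC, Fin.prod_univ_succ, torusPoint, Fin.cons_zero, Fin.cons_succ, Fin.tail]
    rw [mul_comm]

end Cauchy

variable {n : ℕ} {E : Type*} [NormedAddCommGroup E] [InnerProductSpace ℂ E] [CompleteSpace E]

theorem summable_kernel {z : Fin n → ℂ} (hz : z ∈ polydisc n) (e : E) :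
    Summable fun k : Fin n → ℕ =>
      monomialIsometry n E k ((starRingEnd ℂ) (∏ i, z i ^ k i) • e) := by
  refine Summable.of_norm (((summable_norm_prod_pow hz).mul_right ‖e‖).congr fun k => ?_)
  rw [LinearIsometry.norm_map, norm_smul, RCLike.norm_conj]

/-- The Szegő kernel function `w ↦ ∏ i, (1 - w i * conj (z i))⁻¹ e`. -/
def kernelFun (z : Fin n → ℂ) (e : E) : HardySpace n E :=
  ∑' k : Fin n → ℕ, monomialIsometry n E k ((starRingEnd ℂ) (∏ i, z i ^ k i) • e)

theorem kernelFun_apply {z w : Fin n → ℂ} (hz : z ∈ polydisc n) (hw : w ∈ polydisc n) (e : E) :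
    kernelFun z e w = (∏ i, (1 - w i * (starRingEnd ℂ) (z i))⁻¹) • e := by
  have h1 := (summable_kernel hz e).hasSum.mapL (evalCLM n E w)
  have h2 : ∀ k : Fin n → ℕ, evalCLM n E w
      (monomialIsometry n E k ((starRingEnd ℂ) (∏ i, z i ^ k i) • e)) =
        (∏ i, (w i * (starRingEnd ℂ) (z i)) ^ k i) • e := by
    intro k
    rw [evalCLM_apply, monomialIsometry_apply _ _ hw, smul_smul, map_prod,
      ← Finset.prod_mul_distrib]
    simp [mul_pow]
  simp only [h2] at h1
  refine h1.unique ((hasSum_prod_pow fun i => ?_).smul_const e)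
  rw [norm_mul, RCLike.norm_conj]
  exact mul_lt_one_of_nonneg_of_lt_one_left (norm_nonneg _) (hw i) (hz i).le

/-- The reproducing property of the Szegő kernel. -/
theorem inner_kernelFun {z : Fin n → ℂ} (hz : z ∈ polydisc n) (e : E) (f : HardySpace n E) :
    ⟪kernelFun z e, f⟫_ℂ = ⟪e, f z⟫_ℂ := by
  have hr : Tendsto (fun r : Ico (0 : ℝ) 1 => (r : ℝ)) atTop (𝓝 1) := by
    refine tendsto_atTop_isLUB (fun a b h => h) ?_
    rw [Subtype.range_coe]
    exact isLUB_Ico zero_lt_one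
  refine tendsto_nhds_unique (tendsto_integral_inner _ _) ?_
  have hcont : ContinuousAt f z :=
    (f.2.1.differentiableAt ((isOpen_polydisc n).mem_nhds hz)).continuousAt
  -- The point `r² z` is the one for which the conjugated Szegő kernel at `z`, restricted to the
  -- torus of radius `r`, is the Cauchy kernel: `r τ / (r τ - r² z) = (1 - r z conj τ)⁻¹` for `|τ| =
  -- 1`. The mean of the inner products is therefore exactly `⟪e, f (r² z)⟫`, and continuity of `f`
  -- at `z` finishes.
  have hlim : Tendsto (fun r : Ico (0 : ℝ) 1 => (((r : ℝ) ^ 2 : ℝ) : ℂ) • z) atTop (𝓝 z) := by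
    have h1 := (Complex.continuous_ofReal.tendsto _).comp (hr.pow 2)
    have h2 := h1.smul_const z
    simpa [Function.comp_def] using h2
  have hlim2 : Tendsto (fun r : Ico (0 : ℝ) 1 => ⟪e, f ((((r : ℝ) ^ 2 : ℝ) : ℂ) • z)⟫_ℂ) atTop
      (𝓝 ⟪e, f z⟫_ℂ) := tendsto_const_nhds.inner (hcont.tendsto.comp hlim)
  refine hlim2.congr' ?_
  filter_upwards [hr.eventually (lt_mem_nhds zero_lt_one)] with r hr0
  have hτ : ∀ t : UnitAddTorus (Fin n), ((r : ℝ) : ℂ) • torusPoint t ∈ polydisc n :=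
    fun t => smul_torusPoint_mem (by simpa [abs_of_nonneg r.2.1] using r.2.2) t
  have hw : ∀ i, ‖((((r : ℝ) ^ 2 : ℝ) : ℂ) • z) i‖ < r := by
    intro i
    have h1 := hz i
    rw [Pi.smul_apply, norm_smul, Complex.norm_real, Real.norm_of_nonneg (by positivity), sq,
      mul_assoc]
    have h2 : (r : ℝ) * ‖z i‖ < 1 :=
      mul_lt_one_of_nonneg_of_lt_one_left r.2.1 r.2.2 h1.le
    exact mul_lt_of_lt_one_right hr0 h2
  rw [← cauchy_formula r.2.2 n f f.2.1 _ hr0 hw, ← integral_inner]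
  · refine integral_congr_ae (Eventually.of_forall fun t => ?_)
    change ⟪e, _ • _⟫_ℂ = ⟪kernelFun z e (((r : ℝ) : ℂ) • torusPoint t), _⟫_ℂ
    rw [kernelFun_apply hz (hτ t), inner_smul_left, inner_smul_right, map_prod]
    congr 1
    refine Finset.prod_congr rfl fun i _ => ?_
    have h1 : (starRingEnd ℂ) (torusPoint t i) * torusPoint t i = 1 := by
      rw [Complex.conj_mul', torusPoint, Circle.norm_coe]; simp
    have hr1 : ((r : ℝ) : ℂ) ≠ 0 := by exact_mod_cast hr0.ne'
    have ht : torusPoint t i ≠ 0 := fun h0 => by simp [h0] at h1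
    have h2 : ((r : ℝ) : ℂ) * torusPoint t i - ((((r : ℝ) ^ 2 : ℝ) : ℂ) • z) i ≠ 0 :=
      circle_sub_ne_zero (hw i) (t i)
    have h3 : ((r : ℝ) : ℂ) * torusPoint t i - ((((r : ℝ) ^ 2 : ℝ) : ℂ) • z) i =
        ((r : ℝ) : ℂ) * torusPoint t i *
          (1 - ((r : ℝ) : ℂ) * (starRingEnd ℂ) (torusPoint t i) * z i) := by
      simp only [Pi.smul_apply, smul_eq_mul, Complex.ofReal_pow]
      linear_combination (-((r : ℝ) : ℂ) ^ 2 * z i) * h1.symm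
    rw [h3]
    simp only [map_inv₀, map_sub, map_mul, map_one, Complex.conj_conj, Pi.smul_apply, smul_eq_mul,
      Complex.conj_ofReal]
    rw [div_mul_cancel_left₀ (mul_ne_zero hr1 ht)]
  · refine integrable_of_cont (Continuous.smul ?_ (continuous_slice_coe f r.2))
    exact continuous_finsetProd _ fun i _ =>
      (continuous_cauchyKernel (hw i)).comp (continuous_apply i)

/-- Each Szegő kernel is a convergent sum of monomials, so `f` is orthogonal to all kernels, and by
the reproducing property every value of `f` vanishes. -/
theorem eq_zero_of_inner_monomialIsometry {f : HardySpace n E}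
    (h : ∀ k e, ⟪monomialIsometry n E k e, f⟫_ℂ = 0) : f = 0 := by
  refine HardySpace.ext fun z hz => ?_
  refine ext_inner_left ℂ fun e => ?_
  rw [← inner_kernelFun hz, ← inner_conj_symm]
  have h1 := (summable_kernel hz e).hasSum.mapL (innerSL ℂ f)
  have h2 : ∀ k : Fin n → ℕ, innerSL ℂ f
      (monomialIsometry n E k ((starRingEnd ℂ) (∏ i, z i ^ k i) • e)) = 0 := by
    intro k
    rw [innerSL_apply_apply, ← inner_conj_symm, h, map_zero]
  simp only [h2] at h1
  have h3 : ⟪f, kernelFun z e⟫_ℂ = 0 := h1.unique hasSum_zero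
  rw [h3]
  change _ = ⟪e, (0 : E)⟫_ℂ
  simp

theorem topologicalClosure_iSup_range_monomialIsometry :
    (⨆ k, LinearMap.range (monomialIsometry n E k).toLinearMap).topologicalClosure = ⊤ := by
  rw [Submodule.topologicalClosure_eq_top_iff, Submodule.eq_bot_iff]
  intro f hf
  refine eq_zero_of_inner_monomialIsometry fun k e => ?_
  exact (Submodule.mem_orthogonal _ _).1 hf _ (Submodule.mem_iSup_of_mem k ⟨e, rfl⟩)

/-- A closed subspace containing all monomials is everything. -/
theorem mem_of_isClosed {N : Submodule ℂ (HardySpace n E)} (hN : IsClosed (N : Set (HardySpace n E)))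
    (h : ∀ k e, monomialIsometry n E k e ∈ N) (f : HardySpace n E) : f ∈ N := by
  have h1 : (⨆ k, LinearMap.range (monomialIsometry n E k).toLinearMap).topologicalClosure ≤ N := by
    refine Submodule.topologicalClosure_minimal _ (iSup_le fun k => ?_) hN
    rintro _ ⟨e, rfl⟩
    exact h k e
  rw [topologicalClosure_iSup_range_monomialIsometry] at h1
  exact h1 trivial

theorem clm_ext {F : Type*} [NormedAddCommGroup F] [NormedSpace ℂ F]
    {A B : HardySpace n E →L[ℂ] F}
    (h : ∀ k e, A (monomialIsometry n E k e) = B (monomialIsometry n E k e)) : A = B := by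
  ext f
  have := mem_of_isClosed (N := LinearMap.ker (A - B).toLinearMap) (A - B).isClosed_ker
    (fun k e => by simp [h]) f
  simpa [sub_eq_zero] using this

instance [TopologicalSpace.SeparableSpace E] :
    TopologicalSpace.SeparableSpace (HardySpace n E) := by
  rw [← TopologicalSpace.isSeparable_univ_iff]
  have h1 : TopologicalSpace.IsSeparable (Submodule.span ℂ
      (⋃ k, range (monomialIsometry n E k)) : Set (HardySpace n E)) :=
    (TopologicalSpace.IsSeparable.iUnion fun k =>
      TopologicalSpace.isSeparable_range (monomialIsometry n E k).continuous).span
  refine h1.closure.mono fun f _ => ?_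
  exact mem_of_isClosed (N := (Submodule.span ℂ
      (⋃ k, range (monomialIsometry n E k))).topologicalClosure)
    (Submodule.isClosed_topologicalClosure _) (fun k e => Submodule.le_topologicalClosure _
      (Submodule.subset_span (mem_iUnion.2 ⟨k, e, rfl⟩))) f

end HardySpace

/-! ### The shifts and Taylor coefficients. -/

namespace HardySpace

variable {n : ℕ} {E : Type*} [NormedAddCommGroup E] [InnerProductSpace ℂ E] [CompleteSpace E]

/-- On the torus of radius `r` the factor `z_i` has modulus `r`, so the square mean is scaled by
`r²`, which tends to one. -/
theorem norm_shift (i : Fin n) (f : HardySpace n E) : ‖shift n E i f‖ = ‖f‖ := by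
  have h1 : ∀ r : Ico (0 : ℝ) 1, sqMean (shift n E i f) r = (r : ℝ) ^ 2 * sqMean f r := by
    intro r
    unfold sqMean
    rw [← integral_const_mul]
    refine integral_congr_ae (Eventually.of_forall fun t => ?_)
    change ‖shift n E i f _‖ ^ 2 = _
    rw [shift_apply, norm_smul, mul_pow]
    congr 2
    simp [torusPoint, Circle.norm_coe, abs_of_nonneg r.2.1]
  have hr : Tendsto (fun r : Ico (0 : ℝ) 1 => (r : ℝ)) atTop (𝓝 1) := by
    refine tendsto_atTop_isLUB (fun a b h => h) ?_
    rw [Subtype.range_coe]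
    exact isLUB_Ico zero_lt_one
  have h2 := tendsto_sqMean (shift n E i f)
  simp only [h1] at h2
  have h3 := tendsto_nhds_unique h2 ((hr.pow 2).mul (tendsto_sqMean f))
  rw [one_pow, one_mul] at h3
  exact (sq_eq_sq₀ (norm_nonneg _) (norm_nonneg _)).1 h3

theorem adjoint_shift_shift (i : Fin n) (f : HardySpace n E) :
    ((shift n E i)†) (shift n E i f) = f := by
  rw [← ContinuousLinearMap.comp_apply,
    (ContinuousLinearMap.norm_map_iff_adjoint_comp_self _).1 (norm_shift i), one_apply_eq_self]

theorem shift_monomialIsometry (i : Fin n) (k : Fin n → ℕ) (e : E) :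
    shift n E i (monomialIsometry n E k e) = monomialIsometry n E (Pi.single i 1 + k) e := by
  refine HardySpace.ext fun z hz => ?_
  rw [shift_apply, monomialIsometry_apply _ _ hz, monomialIsometry_apply _ _ hz, smul_smul]
  congr 1
  simp only [Pi.add_apply, pow_add, Finset.prod_mul_distrib]
  congr 1
  rw [Finset.prod_eq_single i]
  · simp
  · intro j _ hj
    simp [Pi.single_eq_of_ne hj]
  · simp

theorem adjoint_shift_monomialIsometry_add (i : Fin n) (k : Fin n → ℕ) (e : E) :
    ((shift n E i)†) (monomialIsometry n E (Pi.single i 1 + k) e) = monomialIsometry n E k e := by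
  rw [← shift_monomialIsometry, adjoint_shift_shift]

theorem adjoint_shift_monomialIsometry_eq_zero {i : Fin n} {k : Fin n → ℕ} (hk : k i = 0) (e : E) :
    ((shift n E i)†) (monomialIsometry n E k e) = 0 := by
  refine eq_zero_of_inner_monomialIsometry fun l e' => ?_
  rw [ContinuousLinearMap.adjoint_inner_right, shift_monomialIsometry, inner_monomialIsometry,
    if_neg]
  rintro rfl
  simp at hk

theorem isDoublyCommutingShift_shift (n : ℕ) (E : Type*) [NormedAddCommGroup E]
    [InnerProductSpace ℂ E] [CompleteSpace E] : IsDoublyCommutingShift (shift n E) where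
  commute i j := by
    refine ContinuousLinearMap.ext fun f => HardySpace.ext fun z _ => ?_
    change z i • z j • f z = z j • z i • f z
    rw [smul_comm]
  norm_apply := norm_shift
  adjoint_commute i j hij := by
    refine clm_ext fun k e => ?_
    simp only [mul_apply_eq_comp]
    rcases Nat.eq_zero_or_pos (k i) with h0 | h0
    · rw [adjoint_shift_monomialIsometry_eq_zero h0, shift_monomialIsometry,
        adjoint_shift_monomialIsometry_eq_zero, map_zero]
      simp [h0, hij]
    · obtain ⟨l, rfl⟩ := exists_eq_single_add (i := i) (m := 1) h0
      rw [adjoint_shift_monomialIsometry_add, shift_monomialIsometry, shift_monomialIsometry,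
        add_left_comm, adjoint_shift_monomialIsometry_add]
  pure i := by
    set A := (shift n E i)† with hA
    have hA1 : ∀ m f, ‖(A ^ m) f‖ ≤ ‖f‖ := by
      intro m
      induction m with
      | zero => exact fun f => le_rfl
      | succ m ih =>
        intro f
        rw [pow_succ, mul_apply_eq_comp]
        refine (ih _).trans ((A.le_opNorm f).trans (mul_le_of_le_one_left (norm_nonneg _) ?_))
        rw [hA, LinearIsometryEquiv.norm_map]
        exact ContinuousLinearMap.opNorm_le_bound _ zero_le_one fun x => by
          rw [norm_shift, one_mul]
    have hmon : ∀ (m : ℕ) (k : Fin n → ℕ) (e : E), k i < m →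
        (A ^ m) (monomialIsometry n E k e) = 0 := by
      intro m
      induction m with
      | zero => intro k e h; omega
      | succ m ih =>
        intro k e h
        rw [pow_succ, mul_apply_eq_comp]
        rcases Nat.eq_zero_or_pos (k i) with h0 | h0
        · rw [hA, adjoint_shift_monomialIsometry_eq_zero h0, map_zero]
        · obtain ⟨l, rfl⟩ := exists_eq_single_add (i := i) (m := 1) h0
          rw [hA, adjoint_shift_monomialIsometry_add]
          refine ih l e ?_
          simp at h
          omega
    -- The powers of `A` are contractions, so the vectors on which they tend to zero form a closed
    -- subspace. It contains every monomial, since `A^m` annihilates `z^k` once `m > k i`.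
    let N : Submodule ℂ (HardySpace n E) :=
      { carrier := {f | Tendsto (fun m : ℕ => (A ^ m) f) atTop (𝓝 0)}
        add_mem' := fun {f g} hf hg => by
          have := Tendsto.add hf hg
          simpa using this
        zero_mem' := by simp
        smul_mem' := fun c f hf => by
          have := Tendsto.const_smul hf c
          simpa only [mem_ofPred_eq, map_smul, smul_zero] using this }
    refine mem_of_isClosed (N := N) ?_ fun k e => ?_
    · refine isClosed_of_closure_subset fun f hf => Metric.tendsto_atTop.2 fun ε hε => ?_
      obtain ⟨g, hg, hfg⟩ := Metric.mem_closure_iff.1 hf (ε / 2) (by positivity)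
      obtain ⟨m₀, hm₀⟩ := Metric.tendsto_atTop.1 hg (ε / 2) (by positivity)
      refine ⟨m₀, fun m hm => ?_⟩
      have h1 := hm₀ m hm
      rw [dist_zero_right] at h1 ⊢
      rw [dist_eq_norm] at hfg
      have h2 : (A ^ m) f = (A ^ m) (f - g) + (A ^ m) g := by rw [← map_add, sub_add_cancel]
      rw [h2]
      calc _ ≤ ‖(A ^ m) (f - g)‖ + ‖(A ^ m) g‖ := norm_add_le _ _
        _ < ε := by linarith [hA1 m (f - g)]
    · refine tendsto_const_nhds.congr' ?_
      filter_upwards [eventually_gt_atTop (k i)] with m hm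
      exact (hmon m k e hm).symm

/-- The `k`-th Taylor coefficient as a bounded operator on `H²_E`. -/
def coeff (n : ℕ) (E : Type*) [NormedAddCommGroup E] [InnerProductSpace ℂ E] [CompleteSpace E]
    (k : Fin n → ℕ) : HardySpace n E →L[ℂ] E :=
  (monomialIsometry n E k).toContinuousLinearMap†

theorem inner_coeff (k : Fin n → ℕ) (e : E) (f : HardySpace n E) :
    ⟪e, coeff n E k f⟫_ℂ = ⟪monomialIsometry n E k e, f⟫_ℂ :=
  ContinuousLinearMap.adjoint_inner_right _ _ _

theorem ext_coeff {f g : HardySpace n E} (h : ∀ k, coeff n E k f = coeff n E k g) : f = g := by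
  rw [← sub_eq_zero]
  refine eq_zero_of_inner_monomialIsometry fun k e => ?_
  rw [← inner_coeff, map_sub, h, sub_self, inner_zero_right]

theorem norm_coeff_le (k : Fin n → ℕ) : ‖coeff n E k‖ ≤ 1 := by
  rw [coeff, LinearIsometryEquiv.norm_map]
  exact (monomialIsometry n E k).norm_toContinuousLinearMap_le

theorem coeff_monomialIsometry (k l : Fin n → ℕ) (e : E) :
    coeff n E k (monomialIsometry n E l e) = if k = l then e else 0 := by
  refine ext_inner_left ℂ fun e' => ?_
  rw [inner_coeff, inner_monomialIsometry]
  split_ifs <;> simp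

theorem coeff_adjoint_shift (k : Fin n → ℕ) (i : Fin n) (f : HardySpace n E) :
    coeff n E k (((shift n E i)†) f) = coeff n E (Pi.single i 1 + k) f := by
  refine ext_inner_left ℂ fun e => ?_
  rw [inner_coeff, inner_coeff, ContinuousLinearMap.adjoint_inner_right, shift_monomialIsometry]

/-- The Riesz–Fischer argument: a square-summable family of coefficients is summed along the
orthogonal family of monomials. -/
theorem exists_coeff_eq {a : (Fin n → ℕ) → E} {C : ℝ} (ha : HasSum (fun k => ‖a k‖ ^ 2) C) :
    ∃ f : HardySpace n E, (∀ k, coeff n E k f = a k) ∧ ‖f‖ ^ 2 = C := by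
  have hm : Memℓp a 2 := by
    refine memℓp_gen ?_
    simpa using ha.summable
  set b : lp (fun _ : Fin n → ℕ => E) 2 := ⟨a, hm⟩ with hb
  refine ⟨(orthogonalFamily_monomialIsometry (n := n) (E := E)).linearIsometry b, fun k => ?_, ?_⟩
  · have h1 := ((orthogonalFamily_monomialIsometry (n := n) (E := E)).hasSum_linearIsometry b).mapL
      (coeff n E k)
    simp only [coeff_monomialIsometry] at h1
    have h2 := hasSum_single (f := fun l => if k = l then b l else 0) k
      fun l hl => if_neg (Ne.symm hl)
    rw [if_pos rfl] at h2
    exact h1.unique h2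
  · rw [LinearIsometry.norm_map]
    have h2 := lp.norm_rpow_eq_tsum (p := 2) (by simp) b
    simp only [ENNReal.toReal_ofNat, Real.rpow_ofNat] at h2
    rw [h2]
    exact ha.tsum_eq

/-- An isometry sending `x` to the power series with coefficients `D k x`. -/
theorem exists_isometry_coeff {H : Type*} [NormedAddCommGroup H] [InnerProductSpace ℂ H]
    (D : (Fin n → ℕ) → H →L[ℂ] E) (hD : ∀ x, HasSum (fun k => ‖D k x‖ ^ 2) (‖x‖ ^ 2)) :
    ∃ W : H →ₗᵢ[ℂ] HardySpace n E, ∀ k x, coeff n E k (W x) = D k x := by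
  choose W hW1 hW2 using fun x => exists_coeff_eq (hD x)
  refine ⟨{ toFun := W, map_add' := fun x y => ?_, map_smul' := fun c x => ?_,
            norm_map' := fun x => ?_ }, fun k x => hW1 x k⟩
  · exact ext_coeff fun k => by simp [hW1]
  · exact ext_coeff fun k => by simp [hW1]
  · exact (sq_eq_sq₀ (norm_nonneg _) (norm_nonneg _)).1 (hW2 x)

end HardySpace

/-! ### The Brehmer dilation and the Wold decomposition. -/

section Dilation

variable {n : ℕ} {H : Type*} [NormedAddCommGroup H] [InnerProductSpace ℂ H] [CompleteSpace H]
  {E : Type*} [NormedAddCommGroup E] [InnerProductSpace ℂ E] [CompleteSpace E]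
  {T : Fin n → H →L[ℂ] H} {hT : ∀ i j, Commute (T i) (T j)}

/-- The canonical dilation of a Brehmer tuple to the Hardy space over the polydisc. -/
theorem exists_dilation {D : H →L[ℂ] E}
    (hD : ∀ x, ‖D x‖ ^ 2 =
      ∑ F : Finset (Fin n), (-1) ^ F.card * ‖((tupleProd T hT F)†) x‖ ^ 2)
    (hc : ∀ i, ‖T i‖ ≤ 1) (hp : ∀ i, IsPureOperator (T i)) :
    ∃ W : H →ₗᵢ[ℂ] HardySpace n E,
      (∀ k x, HardySpace.coeff n E k (W x) = D (((tuplePow T hT k)†) x)) ∧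
      ∀ i x, W (((T i)†) x) = ((shift n E i)†) (W x) := by
  obtain ⟨W, hW⟩ := HardySpace.exists_isometry_coeff (fun k => D ∘L (tuplePow T hT k)†)
    (hasSum_norm_sq_defect hD hc hp)
  -- The backward shift moves the coefficient at `k + e_i` to position `k`, and that coefficient is
  -- `D T^{*k} T_i* x`.
  refine ⟨W, hW, fun i x => HardySpace.ext_coeff fun k => ?_⟩
  rw [HardySpace.coeff_adjoint_shift, hW, hW]
  simp only [ContinuousLinearMap.comp_apply]
  rw [adjoint_tuplePow_single_add_apply, pow_one]

/-- The Wold decomposition of a doubly commuting tuple of pure isometries. -/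
theorem IsDoublyCommutingShift.exists_unitary (h : IsDoublyCommutingShift T) :
    ∃ W : H ≃ₗᵢ[ℂ] HardySpace n (wanderingSubspace T),
      ∀ i x, W (T i x) = shift n (wanderingSubspace T) i (W x) := by
  obtain ⟨W, hW, hW2⟩ := exists_dilation (D := (wanderingSubspace T).orthogonalProjectionOnto)
    (hT := h.commute) h.norm_sq_projection h.norm_le_one h.pure
  have hW3 : ∀ i x, W (T i x) = shift n (wanderingSubspace T) i (W x) := by
    intro i x
    set M := shift n (wanderingSubspace T) i with hM
    have h1 : (M†) (W (T i x)) = W x := by rw [hM, ← hW2, h.adjoint_apply_self]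
    -- The dilation only intertwines the adjoints. Here `T_i` and `M` are isometric and `M* W T_i x
    -- = W x`, so expanding the square gives `‖x‖² - 2 ‖x‖² + ‖x‖²`.
    have h2 : ‖W (T i x) - M (W x)‖ ^ 2 = 0 := by
      rw [@norm_sub_sq ℂ, ← ContinuousLinearMap.adjoint_inner_left, h1, hM, HardySpace.norm_shift,
        W.norm_map, W.norm_map, h.norm_apply, inner_self_eq_norm_sq, W.norm_map]
      ring
    rw [← sub_eq_zero, ← norm_eq_zero]
    exact pow_eq_zero_iff two_ne_zero |>.1 h2
  have hclosed : IsClosed (LinearMap.range W.toLinearMap : Set (HardySpace n (wanderingSubspace T))) :=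
    W.isometry.isUniformInducing.isComplete_range.isClosed
  -- For surjectivity, a wandering vector is sent to a constant function because all its higher
  -- coefficients vanish. Applying the shifts then puts every monomial in the range, which is
  -- closed.
  have hmem0 : ∀ η : wanderingSubspace T,
      W (η : H) = HardySpace.monomialIsometry n (wanderingSubspace T) 0 η := by
    intro η
    refine HardySpace.ext_coeff fun k => ?_
    rw [hW, HardySpace.coeff_monomialIsometry]
    split_ifs with hk
    · subst hk
      have : ((1 : H →L[ℂ] H)†) = 1 := star_one _
      simp [this]
    · obtain ⟨i, hi⟩ := Function.ne_iff.1 hk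
      obtain ⟨l, rfl⟩ := exists_eq_single_add (i := i) (m := 1) (Nat.pos_of_ne_zero hi)
      rw [adjoint_tuplePow_single_add_apply, pow_one, mem_wanderingSubspace.1 η.2 i]
      simp
  have hmem : ∀ (η : wanderingSubspace T) (k : Fin n → ℕ),
      HardySpace.monomialIsometry n (wanderingSubspace T) k η ∈ LinearMap.range W.toLinearMap := by
    intro η
    refine multiindex_induction ⟨η, hmem0 η⟩ ?_
    rintro i l ⟨x, hx⟩
    refine ⟨T i x, ?_⟩
    rw [← HardySpace.shift_monomialIsometry, ← hx]
    exact hW3 i x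
  have hsurj : Function.Surjective W := fun f =>
    HardySpace.mem_of_isClosed hclosed (fun k η => hmem η k) f
  exact ⟨LinearIsometryEquiv.ofSurjective W hsurj, hW3⟩

end Dilation

/-! ### Analyticity of point evaluations in operator norm. -/

namespace HardySpace

variable {n : ℕ} {E : Type*} [NormedAddCommGroup E] [InnerProductSpace ℂ E] [CompleteSpace E]

/-- The Taylor expansion holds in operator norm: it converges absolutely because each `coeff` is a
contraction, and its sum is recognized on monomials. -/
theorem hasSum_evalCLM {z : Fin n → ℂ} (hz : z ∈ polydisc n) :
    HasSum (fun k : Fin n → ℕ => (∏ i, z i ^ k i) • coeff n E k) (evalCLM n E z) := by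
  have hs : Summable (fun k : Fin n → ℕ => (∏ i, z i ^ k i) • coeff n E k) := by
    refine Summable.of_norm_bounded (summable_norm_prod_pow hz) fun k => ?_
    rw [norm_smul]
    exact mul_le_of_le_one_right (norm_nonneg _) (norm_coeff_le k)
  have h1 : ∑' k : Fin n → ℕ, (∏ i, z i ^ k i) • coeff n E k = evalCLM n E z := by
    refine clm_ext fun l e => ?_
    have h2 := hs.hasSum.mapL (ContinuousLinearMap.apply ℂ E (monomialIsometry n E l e))
    have h2' : HasSum (fun k : Fin n → ℕ => (∏ i, z i ^ k i) •
        coeff n E k (monomialIsometry n E l e)) ((∑' k : Fin n → ℕ, (∏ i, z i ^ k i) •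
          coeff n E k) (monomialIsometry n E l e)) := h2
    simp only [coeff_monomialIsometry] at h2'
    have h3 : HasSum (fun k : Fin n → ℕ =>
        (∏ i, z i ^ k i) • if k = l then e else 0) ((∏ i, z i ^ l i) • if l = l then e else 0) :=
      hasSum_single l fun k hk => by rw [if_neg hk, smul_zero]
    rw [if_pos rfl] at h3
    rw [h2'.unique h3, evalCLM_apply, monomialIsometry_apply _ _ hz]
  exact h1 ▸ hs.hasSum

/-- Cauchy's estimate on the ball of radius `δ` about `z`, where every coordinate has modulus at
most `ρ + δ`. When `ρ + δ < 1` the bounds are summable in `k`, which permits termwise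
differentiation. -/
theorem norm_fderiv_prod_pow_le {z : Fin n → ℂ} {ρ δ : ℝ} (hz : ‖z‖ < ρ) (hδ : 0 < δ)
    (k : Fin n → ℕ) : ‖fderiv ℂ (fun z : Fin n → ℂ => ∏ i, z i ^ k i) z‖ ≤
      ‖∏ i, (((ρ + δ : ℝ) : ℂ)) ^ k i‖ * 2 / δ := by
  have hρ : 0 ≤ ρ + δ := by linarith [norm_nonneg z]
  refine norm_fderiv_le hδ (norm_nonneg _) (differentiable_prod_pow k).differentiableOn ?_
  intro y hy
  rw [norm_prod, norm_prod]
  refine Finset.prod_le_prod (fun _ _ => norm_nonneg _) fun i _ => ?_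
  rw [norm_pow, norm_pow, Complex.norm_real, Real.norm_of_nonneg hρ]
  refine pow_le_pow_left₀ (norm_nonneg _) ((norm_le_pi_norm y i).trans ?_) _
  rw [Metric.mem_ball, dist_eq_norm] at hy
  calc ‖y‖ = ‖(y - z) + z‖ := by rw [sub_add_cancel]
    _ ≤ ‖y - z‖ + ‖z‖ := norm_add_le _ _
    _ ≤ ρ + δ := by linarith

/-- Evaluation is analytic in the operator norm. -/
theorem differentiableOn_evalCLM : DifferentiableOn ℂ (evalCLM n E) (polydisc n) := by
  intro z₀ hz₀
  have h0 : ‖z₀‖ < 1 := by rwa [polydisc_eq_ball, mem_ball_zero_iff] at hz₀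
  -- The series is differentiated on the ball of radius `ρ`. The gap up to `ρ' < 1` is the radius in
  -- Cauchy's estimate, so the majorant is a geometric series in `ρ'`.
  obtain ⟨ρ, hρ0, hρ1⟩ := exists_between h0
  obtain ⟨ρ', hρ', hρ'1⟩ := exists_between hρ1
  have hδ : 0 < ρ' - ρ := by linarith
  have hsum : Summable fun k : Fin n → ℕ =>
      ‖∏ i, (((ρ + (ρ' - ρ) : ℝ) : ℂ)) ^ k i‖ * 2 / (ρ' - ρ) := by
    refine ((summable_norm_prod_pow (x := fun _ : Fin n => ((ρ + (ρ' - ρ) : ℝ) : ℂ))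
      fun i => ?_).mul_right 2).div_const _
    rw [Complex.norm_real, Real.norm_of_nonneg (by linarith [norm_nonneg z₀])]
    linarith
  have hmem : ∀ z ∈ Metric.ball (0 : Fin n → ℂ) ρ, z ∈ polydisc n := by
    intro z hz
    rw [polydisc_eq_ball, mem_ball_zero_iff]
    rw [mem_ball_zero_iff] at hz
    linarith
  have hz₀ρ : z₀ ∈ Metric.ball (0 : Fin n → ℂ) ρ := by rwa [mem_ball_zero_iff]
  have hd := hasFDerivAt_tsum_of_isPreconnected (𝕜 := ℂ)
    (f := fun (k : Fin n → ℕ) (z : Fin n → ℂ) => (∏ i, z i ^ k i) • coeff n E k)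
    (f' := fun k z => (fderiv ℂ (fun z : Fin n → ℂ => ∏ i, z i ^ k i) z).smulRight (coeff n E k))
    hsum (Metric.isOpen_ball (x := (0 : Fin n → ℂ)) (ε := ρ))
    (convex_ball _ _).isPreconnected
    (fun k z _ => ((differentiable_prod_pow k) z).hasFDerivAt.smul_const (coeff n E k))
    (fun k z hz => by
      rw [ContinuousLinearMap.norm_smulRight_apply]
      refine (mul_le_of_le_one_right (norm_nonneg _) (norm_coeff_le k)).trans ?_
      exact norm_fderiv_prod_pow_le (by rwa [mem_ball_zero_iff] at hz) hδ k)
    hz₀ρ (hasSum_evalCLM (hmem _ hz₀ρ)).summable hz₀ρ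
  refine (hd.congr_of_eventuallyEq ?_).differentiableAt.differentiableWithinAt
  filter_upwards [Metric.isOpen_ball.mem_nhds hz₀ρ] with z hz
  exact (hasSum_evalCLM (hmem z hz)).tsum_eq.symm

end HardySpace

/-! ### Intertwiners of the shifts are multiplication operators. -/

section Multiplier

variable {n : ℕ} {E : Type*} [NormedAddCommGroup E] [InnerProductSpace ℂ E] [CompleteSpace E]
  {F : Type*} [NormedAddCommGroup F] [InnerProductSpace ℂ F] [CompleteSpace F]

open HardySpace

theorem norm_inner_self_eq {G : Type*} [NormedAddCommGroup G] [InnerProductSpace ℂ G] (x : G) :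
    ‖⟪x, x⟫_ℂ‖ = ‖x‖ ^ 2 := by
  rw [inner_self_eq_norm_sq_to_K]
  simp

theorem norm_kernelFun_sq_le {z : Fin n → ℂ} (hz : z ∈ polydisc n) (e : E) :
    ‖kernelFun z e‖ ^ 2 ≤ ‖∏ i, (1 - z i * (starRingEnd ℂ) (z i))⁻¹‖ * ‖e‖ ^ 2 := by
  rw [← norm_inner_self_eq, inner_kernelFun hz, kernelFun_apply hz hz,
    inner_smul_right, norm_mul, norm_inner_self_eq]

/-- Moving the shifts through `V` gives `V (z^k e) = z^k V e`, which proves the claim for monomials;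
density does the rest. The value of `V f` at `z` thus depends only on `f z`, and this dependence
defines the multiplier. -/
theorem apply_eq_of_intertwines {V : HardySpace n F →L[ℂ] HardySpace n E}
    (hV : ∀ i f, V (shift n F i f) = shift n E i (V f)) {z : Fin n → ℂ} (hz : z ∈ polydisc n)
    (f : HardySpace n F) :
    V f z = V (monomialIsometry n F 0 (f z)) z := by
  have h1 : evalCLM n E z ∘L V = (evalCLM n E z ∘L V ∘L
      (monomialIsometry n F 0).toContinuousLinearMap) ∘L evalCLM n F z := by
    refine clm_ext fun k e => ?_
    simp only [ContinuousLinearMap.comp_apply, evalCLM_apply, monomialIsometry_apply _ _ hz,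
      map_smul]
    refine multiindex_induction (p := fun k => V (monomialIsometry n F k e) z =
      (∏ i, z i ^ k i) • V (monomialIsometry n F 0 e) z) (by simp) (fun i l hl => ?_) k
    rw [← shift_monomialIsometry, hV, shift_apply, hl, smul_smul]
    congr 1
    simp only [Pi.add_apply, pow_add, Finset.prod_mul_distrib]
    congr 1
    rw [Finset.prod_eq_single i]
    · simp
    · intro j _ hj
      simp [Pi.single_eq_of_ne hj]
    · simp
  exact DFunLike.congr_fun h1 f

/-- A contraction between Hardy spaces commuting with the shifts is multiplication by a bounded
analytic operator valued function. -/
theorem exists_mulOp_eq {V : HardySpace n F →L[ℂ] HardySpace n E} (hV1 : ∀ f, ‖V f‖ ≤ ‖f‖)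
    (hV : ∀ i f, V (shift n F i f) = shift n E i (V f)) : ∃ Θ : HInfty n F E, mulOp Θ = V := by
  refine ⟨⟨fun z => evalCLM n E z ∘L V ∘L (monomialIsometry n F 0).toContinuousLinearMap,
    differentiableOn_evalCLM.clm_comp (differentiableOn_const _), 1, fun z hz => ?_⟩, ?_⟩
  · refine ContinuousLinearMap.opNorm_le_bound _ zero_le_one fun η => ?_
    rw [one_mul]
    set K := ∏ i, (1 - z i * (starRingEnd ℂ) (z i))⁻¹ with hK
    have hK0 : K ≠ 0 := by
      refine Finset.prod_ne_zero_iff.2 fun i _ => inv_ne_zero ?_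
      rw [Complex.mul_conj', sub_ne_zero]
      have h1 := hz i
      have h2 : ‖z i‖ ^ 2 ≠ 1 := by nlinarith [norm_nonneg (z i)]
      exact_mod_cast h2.symm
    have hKp : 0 < ‖K‖ := norm_pos_iff.2 hK0
    -- The bound `‖Θ(z) η‖ ≤ ‖η‖` is tested on the kernel at `z`, for which `e = K Θ(z) η`. By the
    -- reproducing property `‖e‖²` is the norm of the inner product of the kernel for `e` with `V`
    -- of the kernel for `η`, hence at most `‖K‖ ‖e‖ ‖η‖`. Cancelling `‖e‖` and then `‖K‖` gives the
    -- bound.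
    set e := V (kernelFun z η) z with he
    have h1 : e = K • V (monomialIsometry n F 0 η) z := by
      rw [he, apply_eq_of_intertwines hV hz, kernelFun_apply hz hz, map_smul, map_smul]
      rfl
    have h2 : ‖e‖ ^ 2 ≤ ‖kernelFun z e‖ * ‖kernelFun z η‖ := by
      rw [← norm_inner_self_eq]
      conv_lhs => rw [he, ← he, ← inner_kernelFun hz e]
      exact (norm_inner_le_norm _ _).trans (by gcongr; exact hV1 _)
    have h3 := norm_kernelFun_sq_le hz e
    have h4 := norm_kernelFun_sq_le hz η
    have h5 : (‖e‖ ^ 2) ^ 2 ≤ (‖K‖ * ‖e‖ * ‖η‖) ^ 2 := by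
      calc (‖e‖ ^ 2) ^ 2 ≤ (‖kernelFun z e‖ * ‖kernelFun z η‖) ^ 2 := by gcongr
        _ = ‖kernelFun z e‖ ^ 2 * ‖kernelFun z η‖ ^ 2 := by ring
        _ ≤ (‖K‖ * ‖e‖ ^ 2) * (‖K‖ * ‖η‖ ^ 2) := by gcongr
        _ = _ := by ring
    have h6 : ‖e‖ ^ 2 ≤ ‖K‖ * ‖e‖ * ‖η‖ := le_of_sq_le_sq h5 (by positivity)
    have h7 : ‖e‖ ≤ ‖K‖ * ‖η‖ := by
      rcases (norm_nonneg e).eq_or_lt with h0 | h0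
      · rw [← h0]; positivity
      · nlinarith
    rw [h1, norm_smul] at h7
    exact le_of_mul_le_mul_left h7 hKp
  · refine ContinuousLinearMap.ext fun f => HardySpace.ext fun z hz => ?_
    rw [mulOp_apply]
    exact (apply_eq_of_intertwines hV hz f).symm

end Multiplier

/-! ### Restrictions to invariant subspaces. -/

section Restriction

variable {n : ℕ} {K : Type*} [NormedAddCommGroup K] [InnerProductSpace ℂ K]

/-- The restriction of a tuple of operators to a common invariant subspace. -/
def restrictTuple (M : Fin n → K →L[ℂ] K) (S : Submodule ℂ K) (hS : ∀ i, ∀ x ∈ S, M i x ∈ S)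
    (i : Fin n) : S →L[ℂ] S :=
  (M i ∘L S.subtypeL).codRestrict S fun x => hS i x x.2

variable {M : Fin n → K →L[ℂ] K} {S : Submodule ℂ K} {hS : ∀ i, ∀ x ∈ S, M i x ∈ S}

theorem coe_restrictTuple (i : Fin n) (x : S) : (restrictTuple M S hS i x : K) = M i x := rfl

variable [CompleteSpace K] [CompleteSpace S]

theorem adjoint_restrictTuple (i : Fin n) (x : K) :
    ((restrictTuple M S hS i)†) (S.orthogonalProjectionOnto x) =
      S.orthogonalProjectionOnto (((M i)†) x) := by
  refine ext_inner_right ℂ fun y => ?_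
  rw [ContinuousLinearMap.adjoint_inner_left,
    Submodule.inner_orthogonalProjectionOnto_eq_of_mem_right,
    Submodule.inner_orthogonalProjectionOnto_eq_of_mem_right, coe_restrictTuple,
    ContinuousLinearMap.adjoint_inner_left]

/-- A criterion for the restriction of a doubly commuting tuple of pure isometries to be doubly
commuting. -/
theorem IsDoublyCommutingShift.restrict (h : IsDoublyCommutingShift M)
    (hc : ∀ i j, i ≠ j → ∀ x ∈ S, S.orthogonalProjectionOnto
      (M i (((M j)†) x - S.orthogonalProjectionOnto (((M j)†) x))) = 0) :
    IsDoublyCommutingShift (restrictTuple M S hS) where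
  commute i j := ContinuousLinearMap.ext fun x => Subtype.ext
    (DFunLike.congr_fun (h.commute i j) (x : K))
  norm_apply i x := h.norm_apply i x
  adjoint_commute i j hij := by
    refine ContinuousLinearMap.ext fun x => ?_
    have h1 : ∀ y : S, ((restrictTuple M S hS i)†) y =
        S.orthogonalProjectionOnto (((M i)†) y) := by
      intro y
      rw [← adjoint_restrictTuple (hS := hS), Submodule.orthogonalProjectionOnto_mem_subspace_eq_self]
    rw [mul_apply_eq_comp, mul_apply_eq_comp, h1, h1, coe_restrictTuple]
    have h2 : ((M i)†) (M j x) = M j (((M i)†) x) :=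
      DFunLike.congr_fun (h.adjoint_commute i j hij) (x : K)
    -- With `P` the projection onto `S` and `R` the restricted tuple, `R_i* R_j x = P M_j M_i* x`
    -- while `R_j R_i* x = M_j P M_i* x = P M_j P M_i* x`. The hypothesis says that these agree.
    have h3 := hc j i hij.symm x x.2
    rw [map_sub, map_sub, sub_eq_zero] at h3
    rw [h2, h3]
    exact Submodule.orthogonalProjectionOnto_mem_subspace_eq_self
      (restrictTuple M S hS j (S.orthogonalProjectionOnto (((M i)†) x)))
  pure i x := by
    have h1 : ∀ (m : ℕ) (y : K), (((restrictTuple M S hS i)†) ^ m) (S.orthogonalProjectionOnto y) =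
        S.orthogonalProjectionOnto ((((M i)†) ^ m) y) := by
      intro m
      induction m with
      | zero => exact fun y => rfl
      | succ m ih =>
        intro y
        rw [pow_succ, pow_succ, mul_apply_eq_comp, mul_apply_eq_comp, adjoint_restrictTuple, ih]
    have h2 := (S.orthogonalProjectionOnto.continuous.tendsto 0).comp (h.pure i x)
    rw [map_zero] at h2
    refine h2.congr fun m => ?_
    rw [Function.comp_apply, ← h1, Submodule.orthogonalProjectionOnto_mem_subspace_eq_self]

end Restriction

/-! ### Projections attached to the range of an isometry. -/

section RangeOfIsometry

variable {H K : Type*} [NormedAddCommGroup H] [InnerProductSpace ℂ H] [CompleteSpace H]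
  [NormedAddCommGroup K] [InnerProductSpace ℂ K]

theorem LinearIsometry.isClosed_range (W : H →ₗᵢ[ℂ] K) :
    IsClosed (LinearMap.range W.toLinearMap : Set K) :=
  W.isometry.isUniformInducing.isComplete_range.isClosed

variable [CompleteSpace K]

theorem LinearIsometry.adjoint_apply_self (W : H →ₗᵢ[ℂ] K) (x : H) :
    (W.toContinuousLinearMap†) (W x) = x :=
  DFunLike.congr_fun ((ContinuousLinearMap.norm_map_iff_adjoint_comp_self
    W.toContinuousLinearMap).1 W.norm_map) x

theorem LinearIsometry.mem_orthogonal_range_iff (W : H →ₗᵢ[ℂ] K) (x : K) :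
    x ∈ (LinearMap.range W.toLinearMap)ᗮ ↔ (W.toContinuousLinearMap†) x = 0 := by
  rw [Submodule.mem_orthogonal]
  constructor
  · intro h
    refine ext_inner_left ℂ fun y => ?_
    rw [ContinuousLinearMap.adjoint_inner_right, inner_zero_right]
    exact h _ ⟨y, rfl⟩
  · rintro h _ ⟨y, rfl⟩
    have := ContinuousLinearMap.adjoint_inner_right W.toContinuousLinearMap y x
    rw [h, inner_zero_right] at this
    exact this.symm

/-- The orthogonal projection onto the range of an isometry `W` is `W W*`. -/
theorem LinearIsometry.coe_orthogonalProjectionOnto (W : H →ₗᵢ[ℂ] K) (N : Submodule ℂ K)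
    [CompleteSpace N] (hN : N = LinearMap.range W.toLinearMap) (x : K) :
    (N.orthogonalProjectionOnto x : K) = W ((W.toContinuousLinearMap†) x) := by
  rw [← Submodule.starProjection_apply]
  refine Submodule.eq_starProjection_of_mem_orthogonal ?_ ?_
  · rw [hN]
    exact ⟨_, rfl⟩
  · rw [hN, W.mem_orthogonal_range_iff, map_sub, W.adjoint_apply_self, sub_self]

theorem LinearIsometry.coe_orthogonalProjectionOnto_orthogonal (W : H →ₗᵢ[ℂ] K) (x : K) :
    ((LinearMap.range W.toLinearMap)ᗮ.orthogonalProjectionOnto x : K) =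
      x - W ((W.toContinuousLinearMap†) x) := by
  rw [← Submodule.starProjection_apply]
  refine Submodule.eq_starProjection_of_mem_orthogonal ?_ ?_
  · rw [W.mem_orthogonal_range_iff, map_sub, W.adjoint_apply_self, sub_self]
  · rw [sub_sub_cancel]
    exact Submodule.le_orthogonal_orthogonal _ ⟨_, rfl⟩

end RangeOfIsometry

/-! ### From Beurling quotient modules to Brehmer tuples. -/

section Model

variable {n : ℕ} {Estar E : Type*} [NormedAddCommGroup Estar] [InnerProductSpace ℂ Estar]
  [CompleteSpace Estar] [NormedAddCommGroup E] [InnerProductSpace ℂ E] [CompleteSpace E]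

theorem mulOp_shift (Θ : HInfty n Estar E) (i : Fin n) (f : HardySpace n Estar) :
    mulOp Θ (shift n Estar i f) = shift n E i (mulOp Θ f) :=
  HardySpace.ext fun z _ => map_smul (Θ.toFun z) (z i) (f z)

/-- `M_Θ` as a linear isometry, for an inner function `Θ`. -/
def IsInner.linearIsometry {Θ : HInfty n Estar E} (hΘ : IsInner Θ) :
    HardySpace n Estar →ₗᵢ[ℂ] HardySpace n E where
  toLinearMap := (mulOp Θ).toLinearMap
  norm_map' := (AddMonoidHomClass.isometry_iff_norm _).1 hΘ

theorem adjoint_shift_mem_modelSpace (Θ : HInfty n Estar E) (i : Fin n) {q : HardySpace n E}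
    (hq : q ∈ modelSpace Θ) : ((shift n E i)†) q ∈ modelSpace Θ := by
  refine (Submodule.mem_orthogonal _ _).2 ?_
  rintro _ ⟨f, rfl⟩
  rw [ContinuousLinearMap.adjoint_inner_right]
  have h1 := (Submodule.mem_orthogonal _ _).1 hq _ ⟨shift n Estar i f, rfl⟩
  rwa [ContinuousLinearMap.coe_coe, mulOp_shift] at h1

variable {H : Type*} [NormedAddCommGroup H] [InnerProductSpace ℂ H] [CompleteSpace H]
  {T : Fin n → H →L[ℂ] H}

/-- The model space is invariant under the backward shifts, so the adjoint of the compression is a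
genuine restriction, with no projection. -/
theorem map_adjoint_of_intertwines {Θ : HInfty n Estar E} {U : H ≃ₗᵢ[ℂ] modelSpace Θ}
    (hU : ∀ i x, U (T i x) = compressedShift Θ i (U x)) (i : Fin n) (x : H) :
    (U (((T i)†) x) : HardySpace n E) = ((shift n E i)†) (U x) := by
  set q : modelSpace Θ := ⟨_, adjoint_shift_mem_modelSpace Θ i (U x).2⟩ with hq
  suffices h : ((T i)†) x = U.symm q by rw [h, U.apply_symm_apply]
  refine ext_inner_right ℂ fun y => ?_
  have h1 : ⟪U.symm q, y⟫_ℂ = ⟪q, U y⟫_ℂ := by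
    rw [← U.inner_map_map, U.apply_symm_apply]
  rw [ContinuousLinearMap.adjoint_inner_left, h1, ← U.inner_map_map, hU]
  change ⟪U x, (modelSpace Θ).orthogonalProjectionOnto (shift n E i (U y))⟫_ℂ =
    ⟪((shift n E i)†) (U x : HardySpace n E), (U y : HardySpace n E)⟫_ℂ
  rw [Submodule.inner_orthogonalProjectionOnto_eq_of_mem_left,
    ContinuousLinearMap.adjoint_inner_left]

/-- The tuple of compressed shifts on a Beurling quotient module is a Brehmer tuple with defect
operators annihilating each other. -/
theorem isBrehmer_and_defect_of_unitarilyEquivalent {Θ : HInfty n Estar E} (hΘ : IsInner Θ)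
    (hT : ∀ i j, Commute (T i) (T j)) (hUE : UnitarilyEquivalent T (compressedShift Θ)) :
    IsBrehmer T hT ∧ ∀ i j, i ≠ j → (1 - (T i)† * T i) * (1 - (T j)† * T j) = 0 := by
  obtain ⟨U, hU⟩ := hUE
  set W : H →ₗᵢ[ℂ] HardySpace n E := (modelSpace Θ).subtypeₗᵢ.comp U.toLinearIsometry with hW
  have hWT : ∀ i x, W (((T i)†) x) = ((shift n E i)†) (W x) := map_adjoint_of_intertwines hU
  refine ⟨(HardySpace.isDoublyCommutingShift_shift n E).isBrehmer W hWT, fun i j hij => ?_⟩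
  rw [defect_mul_defect_eq_zero_iff W hWT (fun i f => HardySpace.adjoint_shift_shift i f)]
  intro x
  set V := hΘ.linearIsometry with hV
  have hVM : ∀ i f, V (shift n Estar i f) = shift n E i (V f) := mulOp_shift Θ
  have hrange : modelSpace Θ = LinearMap.range W.toLinearMap := by
    refine le_antisymm (fun q hq => ⟨U.symm ⟨q, hq⟩, ?_⟩) ?_
    · rintro _ ⟨y, rfl⟩
      exact (U y).2
    · change ((U (U.symm ⟨q, hq⟩) : modelSpace Θ) : HardySpace n E) = q
      rw [U.apply_symm_apply]
  have hVa : ∀ i f, (V.toContinuousLinearMap†) (((shift n E i)†) f) =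
      ((shift n Estar i)†) ((V.toContinuousLinearMap†) f) := by
    intro i f
    refine ext_inner_left ℂ fun g => ?_
    rw [ContinuousLinearMap.adjoint_inner_right, ContinuousLinearMap.adjoint_inner_right,
      ContinuousLinearMap.adjoint_inner_right, ContinuousLinearMap.adjoint_inner_right]
    change ⟪shift n E i (V g), f⟫_ℂ = ⟪V (shift n Estar i g), f⟫_ℂ
    rw [hVM]
  have hWW : ∀ f, W ((W.toContinuousLinearMap†) f) = f - V ((V.toContinuousLinearMap†) f) := by
    intro f
    rw [← W.coe_orthogonalProjectionOnto (modelSpace Θ) hrange]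
    exact V.coe_orthogonalProjectionOnto_orthogonal f
  have hcomm : ∀ f, shift n E i (((shift n E j)†) f) = ((shift n E j)†) (shift n E i f) := fun f =>
    (DFunLike.congr_fun ((HardySpace.isDoublyCommutingShift_shift n E).adjoint_commute j i hij.symm) f).symm
  have hcomm' : ∀ f, shift n Estar i (((shift n Estar j)†) f) =
      ((shift n Estar j)†) (shift n Estar i f) := fun f =>
    (DFunLike.congr_fun ((HardySpace.isDoublyCommutingShift_shift n Estar).adjoint_commute j i hij.symm) f).symm
  rw [hWW (_ - _), eq_comm, sub_eq_self]
  -- Since `W W* = 1 - V V*`, the vector is `M_i (M_j* V V* - V V* M_j*) x`. Applying `V*` and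
  -- moving `V` through the shifts leaves `(M_j* M_i - M_i M_j*) V* x`, with the shifts now on the
  -- source Hardy space, and this vanishes by double commutation there.
  have hzero : (V.toContinuousLinearMap†)
      (shift n E i (W ((W.toContinuousLinearMap†) (((shift n E j)†) x))) -
        shift n E i (((shift n E j)†) (W ((W.toContinuousLinearMap†) x)))) = 0 := by
    rw [hWW, hWW, hVa]
    simp only [map_sub, ← hVM, V.adjoint_apply_self]
    rw [hcomm (V _), ← hVM, hVa, V.adjoint_apply_self, hcomm']
    abel
  rw [hzero, map_zero]

/-- The positive square root of `defectOp` serves as `D`, so the coefficient space of the dilation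
can be taken to be `H` itself. -/
theorem exists_sqrt_defect {hT : ∀ i j, Commute (T i) (T j)} (h : (defectOp T hT).IsPositive) :
    ∃ D : H →L[ℂ] H, ∀ x, ‖D x‖ ^ 2 =
      ∑ F : Finset (Fin n), (-1) ^ F.card * ‖((tupleProd T hT F)†) x‖ ^ 2 := by
  have h0 : 0 ≤ defectOp T hT := (ContinuousLinearMap.nonneg_iff_isPositive _).2 h
  refine ⟨CFC.sqrt (defectOp T hT), fun x => ?_⟩
  have h1 : CFC.sqrt (defectOp T hT) * CFC.sqrt (defectOp T hT) = defectOp T hT :=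
    CFC.sqrt_mul_sqrt_self _ h0
  have h2 : (CFC.sqrt (defectOp T hT))† = CFC.sqrt (defectOp T hT) :=
    (IsSelfAdjoint.of_nonneg (CFC.sqrt_nonneg (defectOp T hT))).adjoint_eq
  have h3 := inner_defectOp_self (hT := hT) x
  rw [← h1, mul_apply_eq_comp] at h3
  nth_rewrite 1 [← h2] at h3
  rw [ContinuousLinearMap.adjoint_inner_left, inner_self_eq_norm_sq_to_K] at h3
  exact Complex.ofReal_injective (by simpa using h3)

end Model

/-! ### From Brehmer tuples to Beurling quotient modules. -/

/-- A Brehmer tuple whose defect operators annihilate each other is unitarily equivalent to the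
compressed shifts on a Beurling quotient module. -/
theorem exists_inner_of_isBrehmer {n : ℕ} {H : Type u} [NormedAddCommGroup H]
    [InnerProductSpace ℂ H] [CompleteSpace H] [TopologicalSpace.SeparableSpace H]
    {T : Fin n → H →L[ℂ] H} {hT : ∀ i j, Commute (T i) (T j)} (hc : ∀ i, ‖T i‖ ≤ 1)
    (hB : IsBrehmer T hT)
    (hD : ∀ i j, i ≠ j → (1 - (T i)† * T i) * (1 - (T j)† * T j) = 0) :
    ∃ (Estar : Type u) (_ : NormedAddCommGroup Estar) (_ : InnerProductSpace ℂ Estar)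
      (_ : CompleteSpace Estar) (_ : TopologicalSpace.SeparableSpace Estar)
      (Θ : HInfty n Estar H), IsInner Θ ∧ UnitarilyEquivalent T (compressedShift Θ) := by
  obtain ⟨D, hDx⟩ := exists_sqrt_defect hB.2
  obtain ⟨W, -, hW⟩ := exists_dilation hDx hc hB.1
  have hM := HardySpace.isDoublyCommutingShift_shift n H
  set S : Submodule ℂ (HardySpace n H) := (LinearMap.range W.toLinearMap)ᗮ with hSdef
  have hWM : ∀ i f, (W.toContinuousLinearMap†) (shift n H i f) =
      T i ((W.toContinuousLinearMap†) f) := by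
    intro i f
    refine ext_inner_left ℂ fun y => ?_
    rw [ContinuousLinearMap.adjoint_inner_right, ← ContinuousLinearMap.adjoint_inner_left (T i),
      ContinuousLinearMap.adjoint_inner_right, ← ContinuousLinearMap.adjoint_inner_left]
    change _ = ⟪W (((T i)†) y), f⟫_ℂ
    rw [hW]
    rfl
  have hS : ∀ i, ∀ f ∈ S, shift n H i f ∈ S := by
    intro i f hf
    rw [hSdef, W.mem_orthogonal_range_iff] at hf ⊢
    rw [hWM, hf, map_zero]
  have hR : IsDoublyCommutingShift (restrictTuple (shift n H) S hS) := by
    refine hM.restrict fun i j hij f hf => ?_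
    -- For `f ∈ S` one has `W* f = 0`, so the second term of the criterion drops out and `M_i W W*
    -- M_j* f` lies in the range of `W`. Its projection to `S` is the obstruction to double
    -- commutation of the restricted shifts.
    have h1 := (defect_mul_defect_eq_zero_iff W hW
      (fun i f => HardySpace.adjoint_shift_shift i f) i j).1 (hD i j hij) f
    rw [(W.mem_orthogonal_range_iff f).1 hf] at h1
    simp only [map_zero, sub_zero] at h1
    rw [W.coe_orthogonalProjectionOnto_orthogonal, sub_sub_cancel]
    refine Subtype.ext ?_
    rw [W.coe_orthogonalProjectionOnto_orthogonal, ← h1, sub_self]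
    rfl
  obtain ⟨U, hU⟩ := hR.exists_unitary
  -- The inverse of the Wold unitary, followed by the inclusion of `S`: an isometry between Hardy
  -- spaces that commutes with the shifts and has range `S`.
  set V : HardySpace n (wanderingSubspace (restrictTuple (shift n H) S hS)) →ₗᵢ[ℂ] HardySpace n H :=
    S.subtypeₗᵢ.comp U.symm.toLinearIsometry with hV
  have hVM : ∀ i f, V (shift n _ i f) = shift n H i (V f) := by
    intro i f
    have h1 : U.symm (shift n _ i f) = restrictTuple (shift n H) S hS i (U.symm f) := by
      rw [U.symm_apply_eq, hU, U.apply_symm_apply]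
    exact congrArg Subtype.val h1
  obtain ⟨Θ, hΘ⟩ := exists_mulOp_eq (V := V.toContinuousLinearMap) (fun f => (V.norm_map f).le) hVM
  -- The range of `M_Θ` is `S`, the orthogonal complement of the range of `W`. The latter is closed,
  -- so taking complements again recovers it.
  have hrange : modelSpace Θ = LinearMap.range W.toLinearMap := by
    have h1 : LinearMap.range (mulOp Θ).toLinearMap = S := by
      rw [hΘ]
      refine le_antisymm ?_ fun f hf => ⟨U ⟨f, hf⟩, ?_⟩
      · rintro _ ⟨f, rfl⟩
        exact (U.symm f).2
      · change ((U.symm (U ⟨f, hf⟩) : S) : HardySpace n H) = f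
        rw [U.symm_apply_apply]
    unfold modelSpace
    rw [h1, hSdef, Submodule.orthogonal_orthogonal_eq_closure,
      W.isClosed_range.submodule_topologicalClosure_eq]
  have hmem : ∀ x, W x ∈ modelSpace Θ := fun x => by rw [hrange]; exact ⟨x, rfl⟩
  let Y : H →ₗᵢ[ℂ] modelSpace Θ :=
    { toLinearMap := W.toLinearMap.codRestrict (modelSpace Θ) hmem
      norm_map' := W.norm_map }
  have hY : Function.Surjective Y := by
    rintro ⟨q, hq⟩
    have hq' := hq
    rw [hrange] at hq'
    obtain ⟨x, rfl⟩ := hq'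
    exact ⟨x, rfl⟩
  have : SecondCountableTopology (HardySpace n H) := UniformSpace.secondCountable_of_separable _
  refine ⟨wanderingSubspace (restrictTuple (shift n H) S hS), inferInstance, inferInstance,
    inferInstance, inferInstance, Θ, ?_, LinearIsometryEquiv.ofSurjective Y hY, fun i x => ?_⟩
  · unfold IsInner
    rw [hΘ]
    exact V.isometry
  · refine Subtype.ext ?_
    change W (T i x) = ((modelSpace Θ).orthogonalProjectionOnto (shift n H i (W x)) :
      HardySpace n H)
    -- The projection onto the model space is `W W*`, and `W* M_i W = T_i`.
    rw [W.coe_orthogonalProjectionOnto _ hrange, hWM, W.adjoint_apply_self]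

end

theorem theorem3p2 {n : ℕ} {H : Type u} [NormedAddCommGroup H] [InnerProductSpace ℂ H]
    [CompleteSpace H] [TopologicalSpace.SeparableSpace H] (T : Fin n → H →L[ℂ] H)
    (hcomm : ∀ i j, Commute (T i) (T j)) (hcontr : ∀ i, ‖T i‖ ≤ 1) :
    (∃ (Estar E : Type u)
        (_ : NormedAddCommGroup Estar) (_ : InnerProductSpace ℂ Estar)
        (_ : CompleteSpace Estar) (_ : TopologicalSpace.SeparableSpace Estar)
        (_ : NormedAddCommGroup E) (_ : InnerProductSpace ℂ E)
        (_ : CompleteSpace E) (_ : TopologicalSpace.SeparableSpace E)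
        (Θ : HInfty n Estar E),
        IsInner Θ ∧ UnitarilyEquivalent T (compressedShift Θ)) ↔
      (IsBrehmer T hcomm ∧
        ∀ i j, i ≠ j →
          (1 - ContinuousLinearMap.adjoint (T i) * T i) *
            (1 - ContinuousLinearMap.adjoint (T j) * T j) = 0) := by
  constructor
  · rintro ⟨Estar, E, _, _, _, _, _, _, _, _, Θ, hΘ, hUE⟩
    exact isBrehmer_and_defect_of_unitarilyEquivalent hΘ hcomm hUE
  · rintro ⟨hB, hD⟩
    obtain ⟨Estar, i1, i2, i3, i4, Θ, hΘ, hUE⟩ := exists_inner_of_isBrehmer hcontr hB hD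
    exact ⟨Estar, H, i1, i2, i3, i4, _, _, inferInstance, inferInstance, Θ, hΘ, hUE⟩
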